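/- Let $Y$ be a primitive multiple curve over $\mathbb{C}$ of multiplicity $n$: a Cohen–Macaulay scheme of finite type over $\mathbb{C}$ such that $C=Y_{\mathrm{red}}$ is a smooth connected projective curve, $n$ is the smallest integer with $\mathcal{I}_C^{\,n}=0$ (where $\mathcal{I}_C\subset\mathcal{O}_Y$ is the ideal sheaf of $C$), and every closed point has a neighbourhood in $Y$ that is a locally closed subscheme of a smooth surface. For $1\le i\le n$ let $C_i\subset Y$ be the closed subscheme with ideal sheaf $\mathcal{I}_C^{\,i}$ and $\mathcal{O}_i=\mathcal{O}_{C_i}=\mathcal{O}_Y/\mathcal{I}_C^{\,i}$. For an $\mathcal{O}_Y$-module $\mathcal{F}$ put $\mathcal{F}_i=\mathcal{I}_C^{\,i}\mathcal{F}$, let $\mathcal{F}^{(i)}\subset\mathcal{F}$ be the subsheaf of sections annihilated by $\mathcal{I}_C^{\,i}$, and let $\mathcal{F}_{|C_i}=\mathcal{F}/\mathcal{I}_C^{\,i}\mathcal{F}$, regarded as an $\mathcal{O}_Y$-module. Let $a,b>0$ and $1\le k<n$ be integers, let $\mathcal{E}$ be a coherent sheaf on $Y$ locally isomorphic to $a\mathcal{O}_n\oplus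 b\mathcal{O}_k$, let $\mathbb{E}$ be a vector bundle on $Y$, let $\phi:\mathbb{E}\to\mathcal{E}$ be a surjective morphism inducing an isomorphism $\mathbb{E}_{|C}\simeq\mathcal{E}_{|C}$, and let $\mathcal{L}=\ker\phi$. Then there is a canonical isomorphism of $\mathcal{O}_Y$-modules \[\theta:\ \mathcal{L}_{|C_k}\ \simeq\ (\mathcal{E}^{(k)}/\mathcal{E}_{n-k})\otimes_{\mathcal{O}_Y}\mathcal{I}_C^{\,k}.\] Precisely, there is exactly one isomorphism $\theta$ such that, for every open $U\subset Y$ and all sections $u\in\mathcal{E}^{(k)}(U)$, $s\in\mathcal{I}_C^{\,k}(U)$ and $v\in\mathbb{E}(U)$ with $\phi(v)=u$, the class of $sv\in\mathcal{L}(U)$ in $\mathcal{L}_{|C_k}$ is sent to $[u]\otimes s$, where $[u]$ is the class of $u$ in $\mathcal{E}^{(k)}/\mathcal{E}_{n-k}$. -/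

import Mathlib

open CategoryTheory CategoryTheory.Limits AlgebraicGeometry TopologicalSpace

noncomputable section

namespace MultipleCurve

universe u

section SheavesOfModules

variable {Y : Scheme.{u}}

/-- A subsheaf of `𝒪_Y`-submodules of the `𝒪_Y`-module `M`: a family of submodules of the modules
of sections which is stable under restriction and whose membership is a local condition. -/
structure Subsheaf (M : Y.Modules) where
  obj (U : Y.Opens) : Submodule Γ(Y, U) Γ(M, U)
  res {U V : Y.Opens} (i : V ⟶ U) {s : Γ(M, U)} (hs : s ∈ obj U) :
    M.presheaf.map i.op s ∈ obj V
  local_mem {U : Y.Opens} {s : Γ(M, U)}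
    (hs : ∀ x ∈ U, ∃ (V : Y.Opens) (i : V ⟶ U), x ∈ V ∧ M.presheaf.map i.op s ∈ obj V) :
    s ∈ obj U

namespace Subsheaf

variable {M : Y.Modules}

/-- The underlying presheaf of submodules of a subsheaf. -/
def toSubmodule (N : Subsheaf M) : PresheafOfModules.Submodule M.val where
  obj U := N.obj U.unop
  map f _ hs := N.res f.unop hs

lemma isSheaf (N : Subsheaf M) :
    TopCat.Presheaf.IsSheaf N.toSubmodule.toPresheafOfModules.presheaf := by
  rw [TopCat.Presheaf.isSheaf_iff_isSheafUniqueGluing]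
  intro ι U sf hsf
  let F : TopCat.Sheaf Ab Y := ⟨M.presheaf, M.isSheaf⟩
  let sf' : ∀ i : ι, Γ(M, U i) := fun i ↦ (show N.obj (U i) from sf i).1
  have hsf' : TopCat.Presheaf.IsCompatible M.presheaf U sf' := fun i j ↦
    congrArg Subtype.val (hsf i j)
  obtain ⟨s, hs, hu⟩ := F.existsUnique_gluing U sf' hsf'
  have hmem : s ∈ N.obj (iSup U) := by
    refine N.local_mem fun x hx ↦ ?_
    obtain ⟨i, hi⟩ := Opens.mem_iSup.mp hx
    refine ⟨U i, Opens.leSupr U i, hi, ?_⟩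
    have := hs i
    change M.presheaf.map (Opens.leSupr U i).op s = _ at this
    rw [this]
    exact (show N.obj (U i) from sf i).2
  refine ⟨(⟨s, hmem⟩ : N.obj (iSup U)), fun i ↦ Subtype.ext (hs i), fun t ht ↦ ?_⟩
  exact Subtype.ext (hu (show N.obj (iSup U) from t).1 fun i ↦ congrArg Subtype.val (ht i))

/-- The `𝒪_Y`-module underlying a subsheaf of `M`. -/
def toModules (N : Subsheaf M) : Y.Modules :=
  ⟨N.toSubmodule.toPresheafOfModules, N.isSheaf⟩

/-- The inclusion of a subsheaf of `M` into `M`. -/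
def ι (N : Subsheaf M) : N.toModules ⟶ M :=
  ⟨N.toSubmodule.ι⟩

/-- The inclusion of a subsheaf of `M` into a larger one. -/
def homOfLE {N₁ N₂ : Subsheaf M} (h : ∀ U, N₁.obj U ≤ N₂.obj U) : N₁.toModules ⟶ N₂.toModules :=
  ⟨PresheafOfModules.Submodule.homOfLE (N₁ := N₁.toSubmodule) (N₂ := N₂.toSubmodule)
    (fun U ↦ h U.unop)⟩

end Subsheaf

lemma map_map (M : Y.Modules) {U V W : Y.Opens} (i : V ⟶ U) (j : W ⟶ V) (s : Γ(M, U)) :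
    M.presheaf.map j.op (M.presheaf.map i.op s) = M.presheaf.map (j ≫ i).op s := by
  rw [op_comp, Functor.map_comp]
  rfl

lemma map_mem_ideal (J : Y.IdealSheafData) {V W : Y.affineOpens} (j : W.1 ⟶ V.1) {a : Γ(Y, V.1)}
    (ha : a ∈ J.ideal V) : Y.presheaf.map j.op a ∈ J.ideal W := by
  have h := J.map_ideal (U := W) (V := V) (leOfHom j)
  rw [← h]
  exact Ideal.mem_map_of_mem _ ha

lemma map_mem_ideal_smul (J : Y.IdealSheafData) (M : Y.Modules) {V W : Y.affineOpens}
    (j : W.1 ⟶ V.1) {s : Γ(M, V.1)}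
    (hs : s ∈ (J.ideal V • ⊤ : Submodule Γ(Y, V.1) Γ(M, V.1))) :
    M.presheaf.map j.op s ∈ (J.ideal W • ⊤ : Submodule Γ(Y, W.1) Γ(M, W.1)) := by
  induction hs using Submodule.smul_induction_on' with
  | smul a ha m _ =>
    rw [Scheme.Modules.map_smul]
    exact Submodule.smul_mem_smul (map_mem_ideal J j ha) trivial
  | add x _ y _ hx hy =>
    rw [map_add]
    exact add_mem hx hy

lemma exists_affine (Y : Scheme.{u}) {U : Y.Opens} {x : Y} (hx : x ∈ U) :
    ∃ V : Y.affineOpens, x ∈ V.1 ∧ V.1 ≤ U := by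
  obtain ⟨_, ⟨V, hV, rfl⟩, hxV, hVU⟩ := Y.isBasis_affineOpens.exists_subset_of_mem_open hx U.2
  exact ⟨⟨V, hV⟩, hxV, hVU⟩

lemma eq_zero_of_locally (M : Y.Modules) {U : Y.Opens} (s : Γ(M, U))
    (h : ∀ x ∈ U, ∃ (V : Y.Opens) (i : V ⟶ U), x ∈ V ∧ M.presheaf.map i.op s = 0) : s = 0 := by
  let F : TopCat.Sheaf Ab Y := ⟨M.presheaf, M.isSheaf⟩
  choose V i hxV hV using h
  refine F.eq_of_locally_eq' (fun x : U ↦ V x.1 x.2) U (fun x ↦ i x.1 x.2) ?_ s 0 fun x ↦ ?_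
  · exact fun x hx ↦ Opens.mem_iSup.mpr ⟨⟨x, hx⟩, hxV x hx⟩
  · rw [map_zero]
    exact hV x.1 x.2

/-- The subsheaf `𝒥 M ⊆ M` for an ideal sheaf `𝒥`: its sections are the sections of `M` which,
locally on affine open subsets `V`, lie in `𝒥(V) M(V)`. -/
def idealSMul (J : Y.IdealSheafData) (M : Y.Modules) : Subsheaf M where
  obj U :=
    { carrier := {s | ∀ x ∈ U, ∃ (V : Y.affineOpens) (i : V.1 ⟶ U), x ∈ V.1 ∧
        M.presheaf.map i.op s ∈ (J.ideal V • ⊤ : Submodule Γ(Y, V.1) Γ(M, V.1))}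
      zero_mem' := fun x hx ↦ by
        obtain ⟨V, hxV, hV⟩ := exists_affine Y hx
        refine ⟨V, CategoryTheory.homOfLE hV, hxV, ?_⟩
        rw [map_zero]
        exact zero_mem _
      add_mem' := fun {s t} hs ht x hx ↦ by
        obtain ⟨V₁, i₁, hx₁, h₁⟩ := hs x hx
        obtain ⟨V₂, i₂, hx₂, h₂⟩ := ht x hx
        obtain ⟨V, hxV, hV⟩ := exists_affine Y (U := V₁.1 ⊓ V₂.1) ⟨hx₁, hx₂⟩
        let j₁ : V.1 ⟶ V₁.1 := CategoryTheory.homOfLE (hV.trans inf_le_left)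
        let j₂ : V.1 ⟶ V₂.1 := CategoryTheory.homOfLE (hV.trans inf_le_right)
        refine ⟨V, j₁ ≫ i₁, hxV, ?_⟩
        have e₁ := map_mem_ideal_smul J M j₁ h₁
        have e₂ := map_mem_ideal_smul J M j₂ h₂
        rw [map_map] at e₁ e₂
        rw [map_add]
        exact add_mem e₁ e₂
      smul_mem' := fun a s hs x hx ↦ by
        obtain ⟨V, i, hxV, h⟩ := hs x hx
        refine ⟨V, i, hxV, ?_⟩
        rw [Scheme.Modules.map_smul]
        exact Submodule.smul_mem _ _ h }
  res {U V} i s hs x hx := by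
    obtain ⟨W, j, hxW, h⟩ := hs x (leOfHom i hx)
    obtain ⟨W', hxW', hW'⟩ := exists_affine Y (U := W.1 ⊓ V) ⟨hxW, hx⟩
    refine ⟨W', CategoryTheory.homOfLE (hW'.trans inf_le_right), hxW', ?_⟩
    have e := map_mem_ideal_smul J M (CategoryTheory.homOfLE (hW'.trans inf_le_left)) h
    rw [map_map] at e ⊢
    exact e
  local_mem {U} s hs x hx := by
    obtain ⟨V, i, hxV, h⟩ := hs x hx
    obtain ⟨W, j, hxW, h'⟩ := h x hxV
    refine ⟨W, j ≫ i, hxW, ?_⟩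
    rw [map_map] at h'
    exact h'

/-- The subsheaf of the sections of `M` annihilated by the ideal sheaf `𝒥`. -/
def annihilated (J : Y.IdealSheafData) (M : Y.Modules) : Subsheaf M where
  obj U :=
    { carrier := {s | ∀ (V : Y.affineOpens) (i : V.1 ⟶ U), ∀ a ∈ J.ideal V,
        a • M.presheaf.map i.op s = 0}
      zero_mem' := fun V i a _ ↦ by rw [map_zero, smul_zero]
      add_mem' := fun {s t} hs ht V i a ha ↦ by
        rw [map_add, smul_add, hs V i a ha, ht V i a ha, add_zero]
      smul_mem' := fun c s hs V i a ha ↦ by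
        rw [Scheme.Modules.map_smul, smul_comm, hs V i a ha, smul_zero] }
  res {U V} i s hs W j a ha := by
    rw [map_map]
    exact hs W (j ≫ i) a ha
  local_mem {U} s hs V i a ha := by
    refine eq_zero_of_locally M _ fun x hx ↦ ?_
    obtain ⟨W, j, hxW, h⟩ := hs x (leOfHom i hx)
    obtain ⟨W', hxW', hW'⟩ := exists_affine Y (U := W ⊓ V.1) ⟨hxW, hx⟩
    let l : W'.1 ⟶ V.1 := CategoryTheory.homOfLE (hW'.trans inf_le_right)
    let l' : W'.1 ⟶ W := CategoryTheory.homOfLE (hW'.trans inf_le_left)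
    refine ⟨W'.1, l, hxW', ?_⟩
    have e := h W' l' _ (map_mem_ideal J l ha)
    rw [map_map] at e
    rw [Scheme.Modules.map_smul, map_map]
    exact e

lemma idealSMul_le_annihilated {J K : Y.IdealSheafData} (h : J * K = ⊥) (M : Y.Modules)
    (U : Y.Opens) : (idealSMul J M).obj U ≤ (annihilated K M).obj U := by
  intro s hs V i a ha
  refine eq_zero_of_locally M _ fun x hx ↦ ?_
  obtain ⟨W, j, hxW, hW⟩ := hs x (leOfHom i hx)
  obtain ⟨W', hxW', hW'⟩ := exists_affine Y (U := W.1 ⊓ V.1) ⟨hxW, hx⟩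
  let l : W'.1 ⟶ V.1 := CategoryTheory.homOfLE (hW'.trans inf_le_right)
  let l' : W'.1 ⟶ W.1 := CategoryTheory.homOfLE (hW'.trans inf_le_left)
  refine ⟨W'.1, l, hxW', ?_⟩
  have e := map_mem_ideal_smul J M l' hW
  have ha' := map_mem_ideal K l ha
  rw [map_map] at e
  rw [Scheme.Modules.map_smul, map_map]
  have key : ∀ t ∈ (J.ideal W' • ⊤ : Submodule Γ(Y, W'.1) Γ(M, W'.1)),
      ∀ c ∈ K.ideal W', c • t = 0 := by
    intro t ht c hc
    induction ht using Submodule.smul_induction_on' with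
    | smul b hb m _ =>
      have : b * c ∈ (J * K).ideal W' := Ideal.mul_mem_mul hb hc
      rw [h] at this
      have h0 : b * c = 0 := this
      rw [smul_smul, mul_comm, h0, zero_smul]
    | add x _ y _ hx hy => rw [smul_add, hx, hy, add_zero]
  exact key _ e _ ha'

/-- The presheaf `U ↦ M(U) ⊗_{𝒪_Y(U)} N(U)`. -/
def tensorPresheaf (M N : Y.Modules) : Y.PresheafOfModules :=
  PresheafOfModules.Monoidal.tensorObj (R := Y.presheaf) M.val N.val

/-- The tensor product `M ⊗_{𝒪_Y} N`, the sheaf associated with `U ↦ M(U) ⊗_{𝒪_Y(U)} N(U)`. -/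
def tensor (M N : Y.Modules) : Y.Modules :=
  (PresheafOfModules.sheafification (𝟙 Y.ringCatSheaf.obj)).obj (tensorPresheaf M N)

/-- The section `m ⊗ t` of `M ⊗_{𝒪_Y} N` defined by sections `m` of `M` and `t` of `N`. -/
def tmul {M N : Y.Modules} {U : Y.Opens} (m : Γ(M, U)) (t : Γ(N, U)) : Γ(tensor M N, U) :=
  (((PresheafOfModules.sheafificationAdjunction (𝟙 Y.ringCatSheaf.obj)).unit.app
    (tensorPresheaf M N)).app (.op U)).hom (m ⊗ₜ[Γ(Y, U)] t)

variable (Y) in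
/-- The structure sheaf `𝒪_Y` as a module over itself. -/
def structureSheaf : Y.Modules := SheafOfModules.unit Y.ringCatSheaf

/-- `M` and `N` are locally isomorphic on `Y`. -/
def LocallyIsomorphic (M N : Y.Modules) : Prop :=
  ∀ x : Y, ∃ U : Y.Opens, x ∈ U ∧ Nonempty (M.restrict U.ι ≅ N.restrict U.ι)

/-- Vector bundles: `𝒪_Y`-modules that are locally free of finite rank. -/
def IsVectorBundle (M : Y.Modules) : Prop :=
  ∀ x : Y, ∃ (U : Y.Opens) (r : ℕ), x ∈ U ∧
    Nonempty (M.restrict U.ι ≅ (∐ fun _ : Fin r ↦ structureSheaf Y).restrict U.ι)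

end SheavesOfModules

section Filtrations

/-! Here `C = Y_red`, so that the ideal sheaf `𝓘_C` of `C` in `Y` is `Y.nilradical`, and `C_i` is
the closed subscheme of `Y` with ideal sheaf `𝓘_C ^ i`. -/

variable {Y : Scheme.{u}}

/-- The term `M_i = 𝓘_C ^ i M` of the first canonical filtration of `M`. -/
def firstFiltration (M : Y.Modules) (i : ℕ) : Subsheaf M := idealSMul (Y.nilradical ^ i) M

/-- The term `M^(i)`, the sections annihilated by `𝓘_C ^ i`, of the second canonical filtration
of `M`. -/
def secondFiltration (M : Y.Modules) (i : ℕ) : Subsheaf M := annihilated (Y.nilradical ^ i) M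

/-- The restriction `M|_{C_i} = M / 𝓘_C ^ i M`, as an `𝒪_Y`-module. -/
def restrictTo (M : Y.Modules) (i : ℕ) : Y.Modules := cokernel (firstFiltration M i).ι

/-- The projection `M → M|_{C_i}`. -/
def toRestrict (M : Y.Modules) (i : ℕ) : M ⟶ restrictTo M i := cokernel.π (firstFiltration M i).ι

variable (Y) in
/-- `𝓘_C ^ i` as an `𝒪_Y`-module. -/
def idealPow (i : ℕ) : Y.Modules := (firstFiltration (structureSheaf Y) i).toModules

/-- The inclusion of `𝓘_C ^ i(U)` in `𝒪_Y(U)`. -/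
def idealPow.val {i : ℕ} {U : Y.Opens} (s : Γ(idealPow Y i, U)) : Γ(Y, U) :=
  (firstFiltration (structureSheaf Y) i).ι.app U s

lemma firstFiltration_le_secondFiltration {n k : ℕ} (hn : Y.nilradical ^ n = ⊥) (hk : k ≤ n)
    (M : Y.Modules) (U : Y.Opens) :
    (firstFiltration M (n - k)).obj U ≤ (secondFiltration M k).obj U :=
  idealSMul_le_annihilated (by rw [← pow_add, Nat.sub_add_cancel hk, hn]) M U

/-- The quotient `M^(k) / M_{n-k}`. -/
def filtrationQuotient {n k : ℕ} (hn : Y.nilradical ^ n = ⊥) (hk : k ≤ n) (M : Y.Modules) :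
    Y.Modules :=
  cokernel (Subsheaf.homOfLE (firstFiltration_le_secondFiltration hn hk M))

/-- The projection `M^(k) → M^(k) / M_{n-k}`. -/
def toFiltrationQuotient {n k : ℕ} (hn : Y.nilradical ^ n = ⊥) (hk : k ≤ n) (M : Y.Modules) :
    (secondFiltration M k).toModules ⟶ filtrationQuotient hn hk M :=
  cokernel.π (Subsheaf.homOfLE (firstFiltration_le_secondFiltration hn hk M))

variable (Y) in
/-- The `𝒪_Y`-module `a 𝒪_n ⊕ b 𝒪_k`, where `Y = C_n` and `𝒪_k = 𝒪_Y / 𝓘_C ^ k`. -/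
def quasiFreeModel (a b k : ℕ) : Y.Modules :=
  (∐ fun _ : Fin a ↦ structureSheaf Y) ⨿ (∐ fun _ : Fin b ↦ restrictTo (structureSheaf Y) k)

end Filtrations

section Curves

/-- A Cohen-Macaulay local ring: a Noetherian local ring `R` whose maximal ideal contains an
`R`-regular sequence of length `dim R`. -/
def IsCohenMacaulayLocalRing (R : Type*) [CommRing R] [IsLocalRing R] : Prop :=
  IsNoetherianRing R ∧ ∃ rs : List R, (∀ r ∈ rs, r ∈ IsLocalRing.maximalIdeal R) ∧
    RingTheory.Sequence.IsRegular R rs ∧ (rs.length : WithBot ℕ∞) = ringKrullDim R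

attribute [local instance] MvPolynomial.gradedAlgebra

/-- The projective space `ℙ^N` over `ℂ`. -/
def ProjSpace (N : ℕ) : Scheme.{0} :=
  Proj (MvPolynomial.homogeneousSubmodule (Fin (N + 1)) ℂ)

/-- The structure morphism of `ℙ^N`. -/
def ProjSpace.toSpec (N : ℕ) : ProjSpace N ⟶ Spec (.of ℂ) :=
  Proj.toSpecZero (MvPolynomial.homogeneousSubmodule (Fin (N + 1)) ℂ) ≫
    Spec.map (CommRingCat.ofHom
      (algebraMap ℂ (MvPolynomial.homogeneousSubmodule (Fin (N + 1)) ℂ 0)))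

/-- `X` is projective over `ℂ`. -/
def IsProjective {X : Scheme.{0}} (π : X ⟶ Spec (.of ℂ)) : Prop :=
  ∃ (N : ℕ) (j : X ⟶ ProjSpace N), IsClosedImmersion j ∧ j ≫ ProjSpace.toSpec N = π

/-- `Y_red` is a smooth connected projective curve over `ℂ`. -/
structure ReducedIsSmoothProjectiveCurve {Y : Scheme.{0}} (π : Y ⟶ Spec (.of ℂ)) : Prop where
  smooth : SmoothOfRelativeDimension 1 (Y.nilradical.subschemeι ≫ π)
  connected : ConnectedSpace Y.nilradical.subscheme
  projective : IsProjective (Y.nilradical.subschemeι ≫ π)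

/-- `Y` is a primitive multiple curve of multiplicity `n` over `ℂ`, with support `C = Y_red`:
a Cohen-Macaulay scheme (of finite type) such that `C` is a smooth connected projective curve,
that `n` is the smallest integer with `𝓘_C ^ n = 0`, and that every closed point has a
neighbourhood in `Y` which can be embedded as a locally closed subscheme of a smooth surface. -/
structure IsPrimitiveMultipleCurve {Y : Scheme.{0}} (π : Y ⟶ Spec (.of ℂ)) (n : ℕ) : Prop where
  locallyOfFiniteType : LocallyOfFiniteType π
  support : ReducedIsSmoothProjectiveCurve π
  cohenMacaulay : ∀ x : Y, IsCohenMacaulayLocalRing (Y.presheaf.stalk x)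
  multiplicity : IsLeast {m : ℕ | Y.nilradical ^ m = ⊥} n
  primitive : ∀ x : Y, IsClosed {x} → ∃ (S : Scheme.{0}) (σ : S ⟶ Spec (.of ℂ))
    (U : Y.Opens) (j : (U : Scheme.{0}) ⟶ S), x ∈ U ∧ SmoothOfRelativeDimension 2 σ ∧
      IsImmersion j ∧ j ≫ σ = U.ι ≫ π

end Curves

end MultipleCurve

end

open MultipleCurve

/-!
Near a point the nilradical `𝓘_C` is generated by one section `z` with `z ^ n = 0` which is as
regular as this allows: if `z ^ j * c = 0`, then `c` is a multiple of `z ^ (n - j)`. Hence, in a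
module of the form `a 𝒪_n ⊕ b 𝒪_k`, the sections killed by a power of `z` can be computed coordinate
by coordinate. Since `φ` is an isomorphism modulo `𝓘_C`, the sections of `𝓛` are locally the
`z ^ k v` with `φ v ∈ ℰ^(k)`. This makes `[u] ⊗ s ↦ [s v]`, where `φ v = u`, a well-defined morphism
from `(ℰ^(k) / ℰ_{n-k}) ⊗ 𝓘_C ^ k` to `𝓛|C_k` which is bijective locally, hence an isomorphism; `θ`
is its inverse, and it is unique because every section of `𝓛|C_k` is locally of the form
`[z ^ k v]`.

The section `z` is found at closed points first. There the local ring `R` of `Y` is a quotient of a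
regular local ring `A` of dimension two, and that of `C` is regular of dimension one, so that its
ideal in `A` is principal. The nilradical of `R` is thus generated by one element `z`, and the
maximal ideal by `z` and one more element `t`. The Cohen-Macaulay condition provides a regular
element of `R`; if `z ^ m` is the last nonzero power of `z`, it follows that `z ^ m * t ^ j ≠ 0` for
all `j`, and then that `z` generates the annihilator of `z ^ m`. Such a `z` extends to a
neighbourhood, and `m` is locally constant, hence equal to `n - 1` as `C` is connected.
-/

noncomputable section

namespace MultipleCurve

universe u

open scoped TensorProduct

section Sections

variable {Y : Scheme.{u}} {M N K : Y.Modules} {U V W : Y.Opens}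

/-- Restriction of sections of the structure sheaf along `V ≤ U`, as a ring homomorphism. -/
def ringRes (h : V ≤ U) : Γ(Y, U) →+* Γ(Y, V) :=
  (Y.presheaf.map (CategoryTheory.homOfLE h).op).hom

/-- Restriction of sections of a sheaf of modules along `V ≤ U`, as an additive map. -/
def secRes (h : V ≤ U) : Γ(M, U) →+ Γ(M, V) :=
  (M.presheaf.map (CategoryTheory.homOfLE h).op).hom

lemma presheaf_map_apply (i : V ⟶ U) (s : Γ(M, U)) :
    M.presheaf.map i.op s = secRes (leOfHom i) s := rfl

@[simp] lemma secRes_secRes (h : V ≤ U) (h' : W ≤ V) (s : Γ(M, U)) :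
    secRes h' (secRes h s) = secRes (h'.trans h) s :=
  map_map M (CategoryTheory.homOfLE h) (CategoryTheory.homOfLE h') s

@[simp] lemma secRes_self (h : U ≤ U) (s : Γ(M, U)) : secRes h s = s := by
  change M.presheaf.map (𝟙 U).op s = s
  rw [op_id, M.presheaf.map_id]
  rfl

@[simp] lemma ringRes_ringRes (h : V ≤ U) (h' : W ≤ V) (a : Γ(Y, U)) :
    ringRes h' (ringRes h a) = ringRes (h'.trans h) a := by
  change (Y.presheaf.map (CategoryTheory.homOfLE h).op ≫
    Y.presheaf.map (CategoryTheory.homOfLE h').op).hom a = _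
  rw [← Functor.map_comp]
  rfl

@[simp] lemma ringRes_self (h : U ≤ U) (a : Γ(Y, U)) : ringRes h a = a := by
  change Y.presheaf.map (𝟙 U).op a = a
  rw [op_id, Y.presheaf.map_id]
  rfl

@[simp] lemma secRes_smul (h : V ≤ U) (a : Γ(Y, U)) (s : Γ(M, U)) :
    secRes h (a • s) = ringRes h a • secRes h s :=
  Scheme.Modules.map_smul M _ a s

lemma app_secRes (f : M ⟶ N) (h : V ≤ U) (s : Γ(M, U)) :
    f.app V (secRes h s) = secRes h (f.app U s) :=
  congr($(f.mapPresheaf.naturality (CategoryTheory.homOfLE h).op) s)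

lemma comp_app_apply (f : M ⟶ N) (g : N ⟶ K) (U : Y.Opens) (s : Γ(M, U)) :
    (f ≫ g).app U s = g.app U (f.app U s) := rfl

lemma hom_ext_apply {f g : M ⟶ N} (h : ∀ (U : Y.Opens) (s : Γ(M, U)), f.app U s = g.app U s) :
    f = g := by
  ext U s
  exact h U s

lemma eq_of_local (s t : Γ(M, U))
    (h : ∀ x ∈ U, ∃ (V : Y.Opens) (h : V ≤ U), x ∈ V ∧ secRes h s = secRes h t) : s = t := by
  rw [← sub_eq_zero]
  refine eq_zero_of_locally M _ fun x hx ↦ ?_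
  obtain ⟨V, hVU, hxV, e⟩ := h x hx
  refine ⟨V, CategoryTheory.homOfLE hVU, hxV, ?_⟩
  rw [presheaf_map_apply, map_sub, e, sub_self]

lemma exists_section_of_local (r : ∀ V : Y.Opens, V ≤ U → Γ(M, V) → Prop)
    (res : ∀ {V W : Y.Opens} (h : V ≤ U) (h' : W ≤ V) {p : Γ(M, V)}, r V h p →
      r W (h'.trans h) (secRes h' p))
    (uniq : ∀ {V : Y.Opens} (h : V ≤ U) {p p' : Γ(M, V)}, r V h p → r V h p' → p = p')
    (ex : ∀ x ∈ U, ∃ (V : Y.Opens) (h : V ≤ U) (p : Γ(M, V)), x ∈ V ∧ r V h p) :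
    ∃ p : Γ(M, U), ∀ (V : Y.Opens) (h : V ≤ U) (p' : Γ(M, V)), r V h p' → secRes h p = p' := by
  let F : TopCat.Sheaf Ab Y := ⟨M.presheaf, M.isSheaf⟩
  choose V hVU p hxV hp using fun x : U ↦ ex x.1 x.2
  obtain ⟨q, hq, -⟩ := F.existsUnique_gluing' V U (fun x ↦ CategoryTheory.homOfLE (hVU x))
    (fun x hx ↦ Opens.mem_iSup.mpr ⟨⟨x, hx⟩, hxV ⟨x, hx⟩⟩) p
    fun x y ↦ uniq _ (res (hVU x) inf_le_left (hp x)) (res (hVU y) inf_le_right (hp y))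
  replace hq (x : U) : secRes (hVU x) q = p x := hq x
  refine ⟨q, fun W hW p' hp' ↦ eq_of_local _ _ fun x hx ↦ ?_⟩
  let y : U := ⟨x, hW hx⟩
  refine ⟨W ⊓ V y, inf_le_left, ⟨hx, hxV y⟩, ?_⟩
  rw [secRes_secRes, ← secRes_secRes (hVU y) inf_le_right, hq]
  exact uniq _ (res (hVU y) inf_le_right (hp y)) (res hW inf_le_left hp')

end Sections

section Exactness

variable {Y : Scheme.{u}} {M N K : Y.Modules} {U : Y.Opens}

instance preservesFiniteLimits_sections (U : Y.Opens) : PreservesFiniteLimits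
    (Scheme.Modules.toPresheaf Y ⋙ (evaluation _ Ab).obj (.op U)) := by
  have : PreservesFiniteLimits ((evaluation (Y.Opens)ᵒᵖ Ab).obj (.op U)) := inferInstance
  have : PreservesFiniteLimits (Scheme.Modules.toPresheaf Y) := inferInstance
  exact comp_preservesFiniteLimits _ _

lemma app_injective_of_mono (f : M ⟶ N) [Mono f] (U : Y.Opens) :
    Function.Injective (f.app U) :=
  (AddCommGrpCat.mono_iff_injective _).mp (inferInstanceAs <| Mono <|
    (Scheme.Modules.toPresheaf Y ⋙ (evaluation _ Ab).obj (.op U)).map f)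

lemma exists_app_eq_of_exact (f : M ⟶ N) (g : N ⟶ K) [Mono f] (w : f ≫ g = 0)
    (hfg : (ShortComplex.mk f g w).Exact) {s : Γ(N, U)} (hs : g.app U s = 0) :
    ∃ m, f.app U m = s := by
  let F := Scheme.Modules.toPresheaf Y ⋙ (evaluation _ Ab).obj (.op U)
  have : F.PreservesZeroMorphisms := ⟨fun _ _ ↦ rfl⟩
  have exact_sections := hfg.map_of_mono_of_preservesKernel F ‹_› inferInstance
  exact (ShortComplex.ab_exact_iff _).mp exact_sections s hs

lemma exists_kernel_ι_app_eq (f : M ⟶ N) {s : Γ(M, U)} (hs : f.app U s = 0) :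
    ∃ m, (kernel.ι f).app U m = s :=
  exists_app_eq_of_exact _ f (kernel.condition f)
    (ShortComplex.exact_of_f_is_kernel _ (kernelIsKernel f)) hs

lemma app_kernel_ι_app (f : M ⟶ N) (s : Γ(kernel f, U)) :
    f.app U ((kernel.ι f).app U s) = 0 := by
  rw [← comp_app_apply, kernel.condition]
  rfl

lemma cokernel_π_app_eq_zero_iff (f : M ⟶ N) [Mono f] (s : Γ(N, U)) :
    (cokernel.π f).app U s = 0 ↔ ∃ m, f.app U m = s := by
  refine ⟨exists_app_eq_of_exact f _ (cokernel.condition f)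
    (ShortComplex.exact_of_g_is_cokernel _ (cokernelIsCokernel f)), ?_⟩
  rintro ⟨m, rfl⟩
  rw [← comp_app_apply, cokernel.condition]
  rfl

lemma mono_of_app_injective (f : M ⟶ N) (h : ∀ U, Function.Injective (f.app U)) : Mono f :=
  ⟨fun a b hab ↦ hom_ext_apply fun U s ↦ h U <| by
    rw [← comp_app_apply, hab, comp_app_apply]⟩

namespace Subsheaf

lemma ι_app_mem (P : Subsheaf M) (s : Γ(P.toModules, U)) : P.ι.app U s ∈ P.obj U :=
  (show P.obj U from s).2

lemma exists_ι_app_eq (P : Subsheaf M) {s : Γ(M, U)} (hs : s ∈ P.obj U) :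
    ∃ t : Γ(P.toModules, U), P.ι.app U t = s :=
  ⟨(⟨s, hs⟩ : P.obj U), rfl⟩

lemma ι_app_injective (P : Subsheaf M) (U : Y.Opens) : Function.Injective (P.ι.app U) :=
  Subtype.val_injective (p := (· ∈ P.obj U))

instance (P : Subsheaf M) : Mono P.ι := mono_of_app_injective _ P.ι_app_injective

instance {P Q : Subsheaf M} (h : ∀ U, P.obj U ≤ Q.obj U) : Mono (homOfLE h) :=
  mono_of_mono_fac (show homOfLE h ≫ Q.ι = P.ι from rfl)

lemma cokernel_π_app_eq_zero_iff (P : Subsheaf M) (s : Γ(M, U)) :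
    (cokernel.π P.ι).app U s = 0 ↔ s ∈ P.obj U := by
  rw [MultipleCurve.cokernel_π_app_eq_zero_iff]
  exact ⟨fun ⟨m, hm⟩ ↦ hm ▸ P.ι_app_mem m, P.exists_ι_app_eq⟩

lemma cokernel_π_homOfLE_app_eq_zero_iff {P Q : Subsheaf M} (h : ∀ U, P.obj U ≤ Q.obj U)
    (s : Γ(Q.toModules, U)) :
    (cokernel.π (homOfLE h)).app U s = 0 ↔ Q.ι.app U s ∈ P.obj U := by
  rw [MultipleCurve.cokernel_π_app_eq_zero_iff]
  refine ⟨fun ⟨m, hm⟩ ↦ hm ▸ P.ι_app_mem m, fun hs ↦ ?_⟩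
  obtain ⟨m, hm⟩ := P.exists_ι_app_eq hs
  exact ⟨m, Q.ι_app_injective U hm⟩

end Subsheaf

/-- The image of a morphism of sheaves of modules: the sections that locally come from the
source. -/
def imageSubsheaf (f : M ⟶ N) : Subsheaf N where
  obj U :=
    { carrier := {s | ∀ x ∈ U, ∃ (V : Y.Opens) (h : V ≤ U) (m : Γ(M, V)), x ∈ V ∧
        f.app V m = secRes h s}
      zero_mem' := fun x hx ↦ ⟨U, le_rfl, 0, hx, by simp⟩
      add_mem' := fun {_ _} hs ht x hx ↦ by
        obtain ⟨V, h, m, hV, e⟩ := hs x hx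
        obtain ⟨V', h', m', hV', e'⟩ := ht x hx
        refine ⟨V ⊓ V', inf_le_left.trans h,
          secRes inf_le_left m + secRes inf_le_right m', ⟨hV, hV'⟩, ?_⟩
        rw [map_add, app_secRes, app_secRes, e, e', secRes_secRes, secRes_secRes, map_add]
      smul_mem' := fun a s hs x hx ↦ by
        obtain ⟨V, h, m, hV, e⟩ := hs x hx
        exact ⟨V, h, ringRes h a • m, hV, by
          rw [Scheme.Modules.Hom.app_smul, e, secRes_smul]⟩ }
  res {U V} i s hs x hx := by
    obtain ⟨W, h, m, hW, e⟩ := hs x (leOfHom i hx)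
    refine ⟨W ⊓ V, inf_le_right, secRes inf_le_left m, ⟨hW, hx⟩, ?_⟩
    rw [app_secRes, e, presheaf_map_apply, secRes_secRes, secRes_secRes]
  local_mem {U} s hs x hx := by
    obtain ⟨V, i, hxV, h⟩ := hs x hx
    obtain ⟨W, h, m, hW, e⟩ := h x hxV
    refine ⟨W, h.trans (leOfHom i), m, hW, ?_⟩
    rw [e, presheaf_map_apply, secRes_secRes]

lemma exists_local_preimage (f : M ⟶ N) [Epi f] (s : Γ(N, U)) {x : Y} (hx : x ∈ U) :
    ∃ (V : Y.Opens) (h : V ≤ U) (m : Γ(M, V)), x ∈ V ∧ f.app V m = secRes h s := by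
  have cokernel_eq_zero : cokernel.π (imageSubsheaf f).ι = 0 := by
    rw [← cancel_epi f, comp_zero]
    refine hom_ext_apply fun V m ↦ ?_
    rw [comp_app_apply]
    exact ((imageSubsheaf f).cokernel_π_app_eq_zero_iff _).mpr
      fun x hx ↦ ⟨V, le_rfl, m, hx, by simp⟩
  have : s ∈ (imageSubsheaf f).obj U := by
    rw [← Subsheaf.cokernel_π_app_eq_zero_iff, cokernel_eq_zero]
    rfl
  exact this x hx

lemma epi_of_local_preimage (f : M ⟶ N)
    (h : ∀ (U : Y.Opens) (s : Γ(N, U)), ∀ x ∈ U,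
      ∃ (V : Y.Opens) (h : V ≤ U) (m : Γ(M, V)), x ∈ V ∧ f.app V m = secRes h s) : Epi f := by
  refine ⟨fun a b hab ↦ hom_ext_apply fun U s ↦ eq_of_local _ _ fun x hx ↦ ?_⟩
  obtain ⟨V, hV, m, hxV, e⟩ := h U s x hx
  refine ⟨V, hV, hxV, ?_⟩
  rw [← app_secRes, ← app_secRes, ← e, ← comp_app_apply, hab, comp_app_apply]

end Exactness

section IdealSheaves

variable {Y : Scheme.{u}} {M N : Y.Modules} {U V : Y.Opens} {J : Y.IdealSheafData}

lemma mem_idealSMul_iff {m : Γ(M, U)} :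
    m ∈ (idealSMul J M).obj U ↔ ∀ x ∈ U, ∃ (V : Y.affineOpens) (h : V.1 ≤ U), x ∈ V.1 ∧
      secRes h m ∈ (J.ideal V • ⊤ : Submodule Γ(Y, V.1) Γ(M, V.1)) :=
  forall₂_congr fun _ _ ↦ exists_congr fun _ ↦
    ⟨fun ⟨i, h⟩ ↦ ⟨leOfHom i, h⟩, fun ⟨i, h⟩ ↦ ⟨CategoryTheory.homOfLE i, h⟩⟩

lemma mem_annihilated_iff {m : Γ(M, U)} :
    m ∈ (annihilated J M).obj U ↔ ∀ (V : Y.affineOpens) (h : V.1 ≤ U), ∀ a ∈ J.ideal V,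
      a • secRes h m = 0 :=
  forall_congr' fun _ ↦ ⟨fun h i ↦ h (CategoryTheory.homOfLE i), fun h i ↦ h (leOfHom i)⟩

lemma smul_mem_idealSMul {V : Y.affineOpens} (h : U ≤ V.1) {a : Γ(Y, V.1)} (ha : a ∈ J.ideal V)
    (m : Γ(M, U)) : ringRes h a • m ∈ (idealSMul J M).obj U := by
  refine mem_idealSMul_iff.mpr fun x hx ↦ ?_
  obtain ⟨W, hxW, hWU⟩ := exists_affine Y hx
  refine ⟨W, hWU, hxW, ?_⟩
  rw [secRes_smul, ringRes_ringRes]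
  exact Submodule.smul_mem_smul (map_mem_ideal J (CategoryTheory.homOfLE _) ha) trivial

lemma exists_local_preimage_mem_idealSMul (f : M ⟶ N) [Epi f] {s : Γ(N, U)}
    (hs : s ∈ (idealSMul J N).obj U) {x : Y} (hx : x ∈ U) :
    ∃ (V : Y.Opens) (h : V ≤ U) (m : Γ(M, V)), x ∈ V ∧ m ∈ (idealSMul J M).obj V ∧
      f.app V m = secRes h s := by
  obtain ⟨V, hVU, hxV, hsV⟩ := mem_idealSMul_iff.mp hs x hx
  suffices ∀ t ∈ (J.ideal V • ⊤ : Submodule Γ(Y, V.1) Γ(N, V.1)),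
      ∃ (W : Y.Opens) (h : W ≤ V.1) (m : Γ(M, W)), x ∈ W ∧ m ∈ (idealSMul J M).obj W ∧
        f.app W m = secRes h t by
    obtain ⟨W, h, m, hxW, hm, e⟩ := this _ hsV
    exact ⟨W, h.trans hVU, m, hxW, hm, by rw [e, secRes_secRes]⟩
  intro t ht
  induction ht using Submodule.smul_induction_on' with
  | smul a ha t _ =>
    obtain ⟨W, h, m, hxW, e⟩ := exists_local_preimage f t hxV
    exact ⟨W, h, ringRes h a • m, hxW, smul_mem_idealSMul h ha m, by
      rw [Scheme.Modules.Hom.app_smul, e, secRes_smul]⟩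
  | add t _ t' _ iht iht' =>
    obtain ⟨W, h, m, hxW, hm, e⟩ := iht
    obtain ⟨W', h', m', hxW', hm', e'⟩ := iht'
    refine ⟨W ⊓ W', inf_le_left.trans h, secRes inf_le_left m + secRes inf_le_right m',
      ⟨hxW, hxW'⟩, add_mem ((idealSMul J M).res (CategoryTheory.homOfLE inf_le_left) hm)
        ((idealSMul J M).res (CategoryTheory.homOfLE inf_le_right) hm'), ?_⟩
    rw [map_add, app_secRes, app_secRes, e, e', secRes_secRes, secRes_secRes, map_add]

end IdealSheaves

section CanonicalFiltrations

variable {Y : Scheme.{u}} {M N : Y.Modules} {U V : Y.Opens} {n k : ℕ}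

instance (M : Y.Modules) (k : ℕ) : Epi (toRestrict M k) :=
  inferInstanceAs (Epi (cokernel.π _))

lemma toRestrict_app_eq_zero_iff {m : Γ(M, U)} :
    (toRestrict M k).app U m = 0 ↔ m ∈ (firstFiltration M k).obj U :=
  (firstFiltration M k).cokernel_π_app_eq_zero_iff m

instance (hn : Y.nilradical ^ n = ⊥) (hk : k ≤ n) (M : Y.Modules) :
    Epi (toFiltrationQuotient hn hk M) :=
  inferInstanceAs (Epi (cokernel.π _))

lemma toFiltrationQuotient_app_eq_zero_iff (hn : Y.nilradical ^ n = ⊥) (hk : k ≤ n)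
    {m : Γ((secondFiltration M k).toModules, U)} :
    (toFiltrationQuotient hn hk M).app U m = 0 ↔
      (secondFiltration M k).ι.app U m ∈ (firstFiltration M (n - k)).obj U :=
  Subsheaf.cokernel_π_homOfLE_app_eq_zero_iff _ m

namespace idealPow

lemma val_injective : Function.Injective (val : Γ(idealPow Y k, U) → Γ(Y, U)) :=
  (firstFiltration (structureSheaf Y) k).ι_app_injective U

lemma val_add (s t : Γ(idealPow Y k, U)) : val (s + t) = val s + val t :=
  map_add ((firstFiltration (structureSheaf Y) k).ι.app U).hom s t

lemma val_smul (a : Γ(Y, U)) (s : Γ(idealPow Y k, U)) : val (a • s) = a * val s :=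
  Scheme.Modules.Hom.app_smul (firstFiltration (structureSheaf Y) k).ι a s

lemma val_secRes (h : V ≤ U) (s : Γ(idealPow Y k, U)) :
    val (secRes h s) = ringRes h (val s) :=
  app_secRes (firstFiltration (structureSheaf Y) k).ι h s

lemma exists_local_val_mem (s : Γ(idealPow Y k, U)) {x : Y} (hx : x ∈ U) :
    ∃ (V : Y.affineOpens) (h : V.1 ≤ U), x ∈ V.1 ∧
      ringRes h (val s) ∈ (Y.nilradical ^ k).ideal V := by
  obtain ⟨V, hVU, hxV, hs⟩ :=
    mem_idealSMul_iff.mp ((firstFiltration (structureSheaf Y) k).ι_app_mem s) x hx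
  refine ⟨V, hVU, hxV, ?_⟩
  change ringRes hVU (val s) ∈ ((Y.nilradical ^ k).ideal V • ⊤ : Ideal Γ(Y, V.1)) at hs
  rwa [smul_eq_mul, Ideal.mul_top] at hs

lemma val_smul_mem_firstFiltration (s : Γ(idealPow Y k, U)) (m : Γ(M, U)) :
    val s • m ∈ (firstFiltration M k).obj U := by
  refine mem_idealSMul_iff.mpr fun x hx ↦ ?_
  obtain ⟨V, hVU, hxV, hs⟩ := exists_local_val_mem s hx
  exact ⟨V, hVU, hxV, by
    rw [secRes_smul]
    exact Submodule.smul_mem_smul hs trivial⟩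

lemma val_smul_eq_zero (s : Γ(idealPow Y k, U)) {m : Γ(M, U)}
    (hm : m ∈ (secondFiltration M k).obj U) : val s • m = 0 := by
  refine eq_of_local _ _ fun x hx ↦ ?_
  obtain ⟨V, hVU, hxV, hs⟩ := exists_local_val_mem s hx
  exact ⟨V.1, hVU, hxV, by rw [secRes_smul, mem_annihilated_iff.mp hm V hVU _ hs, map_zero]⟩

end idealPow

end CanonicalFiltrations

section Tensor

variable {Y : Scheme.{u}} {M N P : Y.Modules} {U V : Y.Opens}

/-- The canonical map from the presheaf tensor product to the tensor product. -/
def toTensor (M N : Y.Modules) (U : Y.Opens) :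
    Γ(M, U) ⊗[Γ(Y, U)] Γ(N, U) →ₗ[Γ(Y, U)] Γ(tensor M N, U) :=
  (((PresheafOfModules.sheafificationAdjunction (𝟙 Y.ringCatSheaf.obj)).unit.app
    (tensorPresheaf M N)).app (.op U)).hom

lemma toTensor_tmul (m : Γ(M, U)) (t : Γ(N, U)) :
    toTensor M N U (m ⊗ₜ t) = tmul m t := rfl

lemma tmul_smul (a : Γ(Y, U)) (m : Γ(M, U)) (t : Γ(N, U)) :
    tmul m (a • t) = tmul (a • m) t := by
  rw [← toTensor_tmul, ← TensorProduct.smul_tmul, toTensor_tmul]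

lemma add_tmul (m m' : Γ(M, U)) (t : Γ(N, U)) : tmul (m + m') t = tmul m t + tmul m' t := by
  simp only [← toTensor_tmul, TensorProduct.add_tmul, map_add]

lemma zero_tmul (t : Γ(N, U)) : tmul (0 : Γ(M, U)) t = 0 := by
  rw [← toTensor_tmul, TensorProduct.zero_tmul, map_zero]

lemma secRes_tmul (h : V ≤ U) (m : Γ(M, U)) (t : Γ(N, U)) :
    secRes h (tmul m t) = tmul (secRes h m) (secRes h t) :=
  (PresheafOfModules.naturality_apply
    ((PresheafOfModules.sheafificationAdjunction (𝟙 Y.ringCatSheaf.obj)).unit.app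
      (tensorPresheaf M N)) (CategoryTheory.homOfLE h).op (m ⊗ₜ[Γ(Y, U)] t)).symm

lemma exists_local_toTensor_eq (t : Γ(tensor M N, U)) {x : Y} (hx : x ∈ U) :
    ∃ (V : Y.Opens) (h : V ≤ U) (y : Γ(M, V) ⊗[Γ(Y, V)] Γ(N, V)), x ∈ V ∧
      toTensor M N V y = secRes h t := by
  have locally_surjective : Presheaf.IsLocallySurjective (Opens.grothendieckTopology Y)
    (CategoryTheory.toSheafify (Opens.grothendieckTopology Y) (tensorPresheaf M N).presheaf) :=
      inferInstance
  obtain ⟨V, i, ⟨y, hy⟩, hV⟩ := locally_surjective.imageSieve_mem t x hx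
  exact ⟨V, leOfHom i, y, hV, hy⟩

lemma tensor_hom_ext {f g : tensor M N ⟶ P}
    (h : ∀ (U : Y.Opens) (m : Γ(M, U)) (t : Γ(N, U)), f.app U (tmul m t) = g.app U (tmul m t)) :
    f = g := by
  refine hom_ext_apply fun U t ↦ eq_of_local _ _ fun x hx ↦ ?_
  obtain ⟨V, hVU, y, hxV, e⟩ := exists_local_toTensor_eq t hx
  refine ⟨V, hVU, hxV, ?_⟩
  rw [← app_secRes, ← app_secRes, ← e]
  clear e
  induction y using TensorProduct.induction_on with
  | zero => simp only [map_zero]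
  | tmul m t => exact h V m t
  | add y y' hy hy' => simp only [map_add, hy, hy']

/-- The morphism from the presheaf tensor product defined by bilinear maps
`M(U) × N(U) → P(U)` that commute with restriction. -/
def presheafTensorLift (β : ∀ U : Y.Opens, Γ(M, U) →ₗ[Γ(Y, U)] Γ(N, U) →ₗ[Γ(Y, U)] Γ(P, U))
    (hβ : ∀ {U V : Y.Opens} (h : V ≤ U) (m : Γ(M, U)) (t : Γ(N, U)),
      secRes h (β U m t) = β V (secRes h m) (secRes h t)) : tensorPresheaf M N ⟶ P.val where
  app U := ModuleCat.ofHom (R := Γ(Y, U.unop)) (X := Γ(M, U.unop) ⊗[Γ(Y, U.unop)] Γ(N, U.unop))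
    (Y := Γ(P, U.unop)) (TensorProduct.lift (β U.unop))
  naturality {U V} i := by
    ext (y : Γ(M, U.unop) ⊗[Γ(Y, U.unop)] Γ(N, U.unop))
    let res : Γ(M, U.unop) ⊗[Γ(Y, U.unop)] Γ(N, U.unop) →+
        Γ(M, V.unop) ⊗[Γ(Y, V.unop)] Γ(N, V.unop) :=
      ((tensorPresheaf M N).map i).hom.toAddMonoidHom
    change TensorProduct.lift (β V.unop) (res y) =
      secRes (leOfHom i.unop) (TensorProduct.lift (β U.unop) y)
    induction y using TensorProduct.induction_on with
    | zero => simp only [map_zero]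
    | tmul m t => exact (hβ (leOfHom i.unop) m t).symm
    | add y y' hy hy' => simp only [map_add, hy, hy']

/-- The morphism `M ⊗ N ⟶ P` defined by bilinear maps `M(U) × N(U) → P(U)` that commute with
restriction. -/
def tensorLift (β : ∀ U : Y.Opens, Γ(M, U) →ₗ[Γ(Y, U)] Γ(N, U) →ₗ[Γ(Y, U)] Γ(P, U))
    (hβ : ∀ {U V : Y.Opens} (h : V ≤ U) (m : Γ(M, U)) (t : Γ(N, U)),
      secRes h (β U m t) = β V (secRes h m) (secRes h t)) : tensor M N ⟶ P :=
  ((PresheafOfModules.sheafificationAdjunction (𝟙 Y.ringCatSheaf.obj)).homEquiv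
    (tensorPresheaf M N) P).symm (presheafTensorLift β hβ)

lemma tensorLift_app_tmul
    (β : ∀ U : Y.Opens, Γ(M, U) →ₗ[Γ(Y, U)] Γ(N, U) →ₗ[Γ(Y, U)] Γ(P, U))
    (hβ : ∀ {U V : Y.Opens} (h : V ≤ U) (m : Γ(M, U)) (t : Γ(N, U)),
      secRes h (β U m t) = β V (secRes h m) (secRes h t)) (m : Γ(M, U)) (t : Γ(N, U)) :
    (tensorLift β hβ).app U (tmul m t) = β U m t := by
  let adj := PresheafOfModules.sheafificationAdjunction (𝟙 Y.ringCatSheaf.obj)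
  have unit_comp := (adj.homEquiv_unit _ _ _).symm.trans
    ((adj.homEquiv (tensorPresheaf M N) P).apply_symm_apply (presheafTensorLift β hβ))
  exact congr(($unit_comp).app (.op U) (m ⊗ₜ t : Γ(M, U) ⊗[Γ(Y, U)] Γ(N, U)))

end Tensor

section Comparison

variable {Y : Scheme.{u}} {n k : ℕ} (hn : Y.nilradical ^ n = ⊥) (hk : k ≤ n)
  {E F : Y.Modules} (φ : E ⟶ F) {U V : Y.Opens}

lemma exists_kernel_ι_app_eq_val_smul (s : Γ(idealPow Y k, U)) {v : Γ(E, U)}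
    (hv : φ.app U v ∈ (secondFiltration F k).obj U) :
    ∃ l, (kernel.ι φ).app U l = idealPow.val s • v :=
  exists_kernel_ι_app_eq φ <| by
    rw [Scheme.Modules.Hom.app_smul, idealPow.val_smul_eq_zero s hv]

include hn hk in
lemma mem_firstFiltration_kernel [Epi φ] {s : Γ(idealPow Y k, U)} {v : Γ(E, U)}
    {l : Γ(kernel φ, U)} (hv : φ.app U v ∈ (firstFiltration F (n - k)).obj U)
    (hl : (kernel.ι φ).app U l = idealPow.val s • v) :
    l ∈ (firstFiltration (kernel φ) k).obj U := by
  refine (firstFiltration (kernel φ) k).local_mem fun x hx ↦ ?_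
  obtain ⟨V, hVU, e, hxV, he, hφe⟩ := exists_local_preimage_mem_idealSMul φ hv hx
  obtain ⟨l', hl'⟩ := exists_kernel_ι_app_eq φ (s := secRes hVU v - e) <| by
    rw [map_sub, hφe, app_secRes, sub_self]
  have se_eq_zero : idealPow.val (secRes hVU s) • e = 0 :=
    idealPow.val_smul_eq_zero _ (firstFiltration_le_secondFiltration hn hk E V he)
  have l_eq : secRes hVU l = idealPow.val (secRes hVU s) • l' := by
    apply app_injective_of_mono (kernel.ι φ) V
    rw [Scheme.Modules.Hom.app_smul, hl', smul_sub, se_eq_zero, sub_zero, app_secRes, hl,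
      secRes_smul, idealPow.val_secRes]
  refine ⟨V, CategoryTheory.homOfLE hVU, hxV, ?_⟩
  rw [presheaf_map_apply, l_eq]
  exact idealPow.val_smul_mem_firstFiltration _ _

/-- The relation between `[u]`, `s` and `[s v]`, for sections `u` of `F^(k)`, `s` of `𝓘_C ^ k` and
`v` of `E` with `φ v = u`: it is the graph, in sections, of the inverse of the canonical
isomorphism. -/
def ComparisonRel (m : Γ(filtrationQuotient hn hk F, U)) (s : Γ(idealPow Y k, U))
    (p : Γ(restrictTo (kernel φ) k, U)) : Prop :=
  ∃ (u : Γ((secondFiltration F k).toModules, U)) (v : Γ(E, U)) (l : Γ(kernel φ, U)),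
    φ.app U v = (secondFiltration F k).ι.app U u ∧
    (kernel.ι φ).app U l = idealPow.val s • v ∧
    (toFiltrationQuotient hn hk F).app U u = m ∧ (toRestrict (kernel φ) k).app U l = p

namespace ComparisonRel

variable {hn hk φ} {m m' : Γ(filtrationQuotient hn hk F, U)} {s s' : Γ(idealPow Y k, U)}
  {p p' : Γ(restrictTo (kernel φ) k, U)}

lemma add_left (h : ComparisonRel hn hk φ m s p) (h' : ComparisonRel hn hk φ m' s p') :
    ComparisonRel hn hk φ (m + m') s (p + p') := by
  obtain ⟨u, v, l, hv, hl, rfl, rfl⟩ := h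
  obtain ⟨u', v', l', hv', hl', rfl, rfl⟩ := h'
  exact ⟨u + u', v + v', l + l', by rw [map_add, map_add, hv, hv'],
    by rw [map_add, hl, hl', smul_add], map_add _ _ _, map_add _ _ _⟩

lemma smul_left (a : Γ(Y, U)) (h : ComparisonRel hn hk φ m s p) :
    ComparisonRel hn hk φ (a • m) s (a • p) := by
  obtain ⟨u, v, l, hv, hl, rfl, rfl⟩ := h
  refine ⟨a • u, a • v, a • l, ?_, ?_, ?_, ?_⟩ <;>
    simp only [Scheme.Modules.Hom.app_smul, hv, hl, smul_comm a]

lemma smul_right (a : Γ(Y, U)) (h : ComparisonRel hn hk φ m s p) :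
    ComparisonRel hn hk φ m (a • s) (a • p) := by
  obtain ⟨u, v, l, hv, hl, rfl, rfl⟩ := h
  refine ⟨u, v, a • l, hv, ?_, rfl, ?_⟩ <;>
    simp only [Scheme.Modules.Hom.app_smul, hl, idealPow.val_smul, mul_smul]

lemma secRes (i : V ≤ U) (h : ComparisonRel hn hk φ m s p) :
    ComparisonRel hn hk φ (secRes i m) (secRes i s) (secRes i p) := by
  obtain ⟨u, v, l, hv, hl, rfl, rfl⟩ := h
  refine ⟨MultipleCurve.secRes i u, MultipleCurve.secRes i v, MultipleCurve.secRes i l,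
    ?_, ?_, ?_, ?_⟩ <;>
    simp only [app_secRes, hv, hl, secRes_smul, idealPow.val_secRes]

lemma unique [Epi φ] (h : ComparisonRel hn hk φ m s p) (h' : ComparisonRel hn hk φ m s p') :
    p = p' := by
  have diff : ComparisonRel hn hk φ 0 s (p - p') := by
    simpa [sub_eq_add_neg] using h.add_left (h'.smul_left (-1))
  obtain ⟨u, v, l, hv, hl, hu, hp⟩ := diff
  rw [← sub_eq_zero, ← hp, toRestrict_app_eq_zero_iff]
  exact mem_firstFiltration_kernel hn hk φ
    (hv ▸ (toFiltrationQuotient_app_eq_zero_iff hn hk).mp hu) hl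

lemma add_right [Epi φ] (h : ComparisonRel hn hk φ m s p) (h' : ComparisonRel hn hk φ m s' p') :
    ComparisonRel hn hk φ m (s + s') (p + p') := by
  obtain ⟨u, v, l, hv, hl, rfl, rfl⟩ := h
  obtain ⟨l', hl'⟩ := exists_kernel_ι_app_eq_val_smul φ s'
    (hv ▸ (secondFiltration F k).ι_app_mem u)
  obtain rfl := unique h' ⟨u, v, l', hv, hl', rfl, rfl⟩
  exact ⟨u, v, l + l', hv, by rw [map_add, hl, hl', idealPow.val_add, add_smul], rfl,
    map_add _ _ _⟩

lemma exists_local [Epi φ] (m : Γ(filtrationQuotient hn hk F, U)) (s : Γ(idealPow Y k, U)) {x : Y}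
    (hx : x ∈ U) : ∃ (V : Y.Opens) (h : V ≤ U) (p : Γ(restrictTo (kernel φ) k, V)), x ∈ V ∧
      ComparisonRel hn hk φ (MultipleCurve.secRes h m) (MultipleCurve.secRes h s) p := by
  obtain ⟨V, hVU, u, hxV, hu⟩ := exists_local_preimage (toFiltrationQuotient hn hk F) m hx
  obtain ⟨W, hWV, v, hxW, hv⟩ :=
    exists_local_preimage φ ((secondFiltration F k).ι.app V u) hxV
  rw [← app_secRes] at hv
  obtain ⟨l, hl⟩ := exists_kernel_ι_app_eq_val_smul φ (MultipleCurve.secRes (hWV.trans hVU) s)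
    (hv ▸ (secondFiltration F k).ι_app_mem _)
  exact ⟨W, hWV.trans hVU, _, hxW, MultipleCurve.secRes hWV u, v, l, hv, hl,
    by rw [app_secRes, hu, secRes_secRes], rfl⟩

lemma exists_section [Epi φ] (m : Γ(filtrationQuotient hn hk F, U)) (s : Γ(idealPow Y k, U)) :
    ∃ p : Γ(restrictTo (kernel φ) k, U), ∀ (V : Y.Opens) (h : V ≤ U) (p'),
      ComparisonRel hn hk φ (MultipleCurve.secRes h m) (MultipleCurve.secRes h s) p' →
        MultipleCurve.secRes h p = p' :=
  exists_section_of_local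
    (fun _ h ↦ ComparisonRel hn hk φ (MultipleCurve.secRes h m) (MultipleCurve.secRes h s))
    (fun _ h' _ hp ↦ by simpa only [secRes_secRes] using hp.secRes h')
    (fun _ _ _ ↦ unique) fun _ ↦ exists_local m s

end ComparisonRel

variable [Epi φ]

/-- The section of `(ker φ)|_{C_k}` obtained by gluing the local sections `[s v]`, where
`m = [φ v]`. -/
def comparisonSection (m : Γ(filtrationQuotient hn hk F, U)) (s : Γ(idealPow Y k, U)) :
    Γ(restrictTo (kernel φ) k, U) :=
  (ComparisonRel.exists_section m s).choose

variable {hn hk φ}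

lemma secRes_comparisonSection_eq (h : V ≤ U) {m : Γ(filtrationQuotient hn hk F, U)}
    {s : Γ(idealPow Y k, U)} {p : Γ(restrictTo (kernel φ) k, V)}
    (hp : ComparisonRel hn hk φ (secRes h m) (secRes h s) p) :
    secRes h (comparisonSection hn hk φ m s) = p :=
  (ComparisonRel.exists_section m s).choose_spec V h p hp

lemma comparisonSection_eq {m : Γ(filtrationQuotient hn hk F, U)}
    {s : Γ(idealPow Y k, U)} {p : Γ(restrictTo (kernel φ) k, U)}
    (hp : ComparisonRel hn hk φ m s p) : comparisonSection hn hk φ m s = p := by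
  simpa using secRes_comparisonSection_eq le_rfl (hp.secRes le_rfl)

lemma secRes_comparisonSection (h : V ≤ U) (m : Γ(filtrationQuotient hn hk F, U))
    (s : Γ(idealPow Y k, U)) :
    secRes h (comparisonSection hn hk φ m s) =
      comparisonSection hn hk φ (secRes h m) (secRes h s) := by
  refine eq_of_local _ _ fun x hx ↦ ?_
  obtain ⟨W, hWV, p, hxW, hp⟩ := ComparisonRel.exists_local (φ := φ) (secRes h m) (secRes h s) hx
  refine ⟨W, hWV, hxW, ?_⟩
  rw [secRes_comparisonSection_eq hWV hp, secRes_secRes]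
  exact secRes_comparisonSection_eq _ (by simpa only [secRes_secRes] using hp)

lemma comparisonSection_eq_of_local {m : Γ(filtrationQuotient hn hk F, U)}
    {s : Γ(idealPow Y k, U)} {p : Γ(restrictTo (kernel φ) k, U)}
    (h : ∀ x ∈ U, ∃ (V : Y.Opens) (h : V ≤ U), x ∈ V ∧
      ComparisonRel hn hk φ (secRes h m) (secRes h s) (secRes h p)) :
    comparisonSection hn hk φ m s = p :=
  eq_of_local _ _ fun x hx ↦ by
    obtain ⟨V, hVU, hxV, hp⟩ := h x hx
    exact ⟨V, hVU, hxV, secRes_comparisonSection_eq hVU hp⟩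

lemma exists_local_comparisonRel (m : Γ(filtrationQuotient hn hk F, U)) (s : Γ(idealPow Y k, U))
    {x : Y} (hx : x ∈ U) : ∃ (V : Y.Opens) (h : V ≤ U), x ∈ V ∧
      ComparisonRel hn hk φ (secRes h m) (secRes h s)
        (secRes h (comparisonSection hn hk φ m s)) := by
  obtain ⟨V, hVU, p, hxV, hp⟩ := ComparisonRel.exists_local (φ := φ) m s hx
  exact ⟨V, hVU, hxV, by rwa [secRes_comparisonSection_eq hVU hp]⟩

variable (m m' : Γ(filtrationQuotient hn hk F, U)) (s s' : Γ(idealPow Y k, U)) (a : Γ(Y, U))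

lemma comparisonSection_add_left : comparisonSection hn hk φ (m + m') s =
    comparisonSection hn hk φ m s + comparisonSection hn hk φ m' s := by
  refine comparisonSection_eq_of_local fun x hx ↦ ?_
  obtain ⟨V, hVU, hxV, hm⟩ := exists_local_comparisonRel (φ := φ) m s hx
  obtain ⟨W, hWU, hxW, hm'⟩ := exists_local_comparisonRel (φ := φ) m' s hx
  have hmV := hm.secRes (V := V ⊓ W) inf_le_left
  have hmW := hm'.secRes (V := V ⊓ W) inf_le_right
  simp only [secRes_secRes] at hmV hmW
  exact ⟨V ⊓ W, inf_le_left.trans hVU, ⟨hxV, hxW⟩, by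
    simpa only [map_add] using hmV.add_left hmW⟩

lemma comparisonSection_add_right : comparisonSection hn hk φ m (s + s') =
    comparisonSection hn hk φ m s + comparisonSection hn hk φ m s' := by
  refine comparisonSection_eq_of_local fun x hx ↦ ?_
  obtain ⟨V, hVU, hxV, hs⟩ := exists_local_comparisonRel (φ := φ) m s hx
  obtain ⟨W, hWU, hxW, hs'⟩ := exists_local_comparisonRel (φ := φ) m s' hx
  have hsV := hs.secRes (V := V ⊓ W) inf_le_left
  have hsW := hs'.secRes (V := V ⊓ W) inf_le_right
  simp only [secRes_secRes] at hsV hsW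
  exact ⟨V ⊓ W, inf_le_left.trans hVU, ⟨hxV, hxW⟩, by
    simpa only [map_add] using hsV.add_right hsW⟩

lemma comparisonSection_smul_left :
    comparisonSection hn hk φ (a • m) s = a • comparisonSection hn hk φ m s := by
  refine comparisonSection_eq_of_local fun x hx ↦ ?_
  obtain ⟨V, hVU, hxV, hm⟩ := exists_local_comparisonRel (φ := φ) m s hx
  exact ⟨V, hVU, hxV, by simpa only [secRes_smul] using hm.smul_left (ringRes hVU a)⟩

lemma comparisonSection_smul_right :
    comparisonSection hn hk φ m (a • s) = a • comparisonSection hn hk φ m s := by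
  refine comparisonSection_eq_of_local fun x hx ↦ ?_
  obtain ⟨V, hVU, hxV, hs⟩ := exists_local_comparisonRel (φ := φ) m s hx
  exact ⟨V, hVU, hxV, by simpa only [secRes_smul] using hs.smul_right (ringRes hVU a)⟩

variable (hn hk φ) in
/-- The canonical morphism `(F^(k) / F_{n-k}) ⊗ 𝓘_C ^ k ⟶ (ker φ)|_{C_k}`, `[u] ⊗ s ↦ [s v]`, where
`φ v = u`. -/
def comparisonHom :
    tensor (filtrationQuotient hn hk F) (idealPow Y k) ⟶ restrictTo (kernel φ) k :=
  tensorLift (fun U ↦ LinearMap.mk₂ Γ(Y, U) (comparisonSection hn hk φ)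
    comparisonSection_add_left (fun a m s ↦ comparisonSection_smul_left m s a)
    comparisonSection_add_right (fun a m s ↦ comparisonSection_smul_right m s a))
    secRes_comparisonSection

lemma comparisonHom_app_tmul :
    (comparisonHom hn hk φ).app U (tmul m s) = comparisonSection hn hk φ m s :=
  tensorLift_app_tmul _ _ m s

variable {m s} in
lemma comparisonHom_app_tmul_of_rel {p : Γ(restrictTo (kernel φ) k, U)}
    (hp : ComparisonRel hn hk φ m s p) : (comparisonHom hn hk φ).app U (tmul m s) = p :=
  (comparisonHom_app_tmul m s).trans (comparisonSection_eq hp)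

lemma comparisonHom_comp_eq_id
    {θ : restrictTo (kernel φ) k ⟶ tensor (filtrationQuotient hn hk F) (idealPow Y k)}
    (hθ : ∀ {U : Y.Opens} {m s p}, ComparisonRel hn hk φ (U := U) m s p →
      θ.app U p = tmul m s) : comparisonHom hn hk φ ≫ θ = 𝟙 _ := by
  refine tensor_hom_ext fun U m s ↦ eq_of_local _ _ fun x hx ↦ ?_
  obtain ⟨V, hVU, hxV, h⟩ := exists_local_comparisonRel (φ := φ) m s hx
  refine ⟨V, hVU, hxV, ?_⟩
  rw [← app_secRes, secRes_tmul, comp_app_apply, comparisonHom_app_tmul_of_rel h, hθ h,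
    ← secRes_tmul]
  rfl

end Comparison

section LocalParameter

variable {Y : Scheme.{u}} {M : Y.Modules} {n : ℕ} {V U W : Y.Opens} {z : Γ(Y, V)}

/-- `z` is a local equation on `V` of the reduced subscheme `C` of `Y`, with `z ^ n = 0`, such that
the annihilator of `z ^ k` is generated by `z ^ (n - k)`. -/
structure IsLocalParameter (n : ℕ) (V : Y.Opens) (z : Γ(Y, V)) : Prop where
  ideal_eq (W : Y.affineOpens) (h : W.1 ≤ V) : Y.nilradical.ideal W = Ideal.span {ringRes h z}
  pow_eq_zero : z ^ n = 0
  dvd_of_pow_mul_eq_zero (W : Y.affineOpens) (h : W.1 ≤ V) (k : ℕ) (hk : k ≤ n)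
    (c : Γ(Y, W.1)) (hc : ringRes h z ^ k * c = 0) : ringRes h z ^ (n - k) ∣ c

variable (Y) in
/-- `𝓘_C` is locally generated by local parameters. -/
def HasLocalParameters (n : ℕ) : Prop :=
  ∀ x : Y, ∃ (V : Y.Opens) (z : Γ(Y, V)), x ∈ V ∧ IsLocalParameter n V z

namespace IsLocalParameter

lemma pow_ideal_eq (hz : IsLocalParameter n V z) (W : Y.affineOpens) (h : W.1 ≤ V) (i : ℕ) :
    (Y.nilradical ^ i).ideal W = Ideal.span {ringRes h z ^ i} := by
  rw [Scheme.IdealSheafData.ideal_pow, Pi.pow_apply, hz.ideal_eq W h, Ideal.span_singleton_pow]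

lemma mem_firstFiltration_iff (hz : IsLocalParameter n V z) (hU : U ≤ V) (i : ℕ) (m : Γ(M, U)) :
    m ∈ (firstFiltration M i).obj U ↔ ∀ x ∈ U, ∃ (W : Y.Opens) (h : W ≤ U) (m' : Γ(M, W)),
      x ∈ W ∧ secRes h m = ringRes (h.trans hU) z ^ i • m' := by
  refine mem_idealSMul_iff.trans ⟨fun hm x hx ↦ ?_, fun hm x hx ↦ ?_⟩
  · obtain ⟨W, h, hxW, hW⟩ := hm x hx
    rw [hz.pow_ideal_eq W (h.trans hU), Submodule.ideal_span_singleton_smul,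
      Submodule.mem_smul_pointwise_iff_exists] at hW
    obtain ⟨m', -, e⟩ := hW
    exact ⟨W.1, h, m', hxW, e.symm⟩
  · obtain ⟨W, h, m', hxW, e⟩ := hm x hx
    obtain ⟨W', hxW', hW'⟩ := exists_affine Y hxW
    refine ⟨W', hW'.trans h, hxW', ?_⟩
    rw [← secRes_secRes h hW', e, secRes_smul, map_pow, ringRes_ringRes,
      hz.pow_ideal_eq W' (hW'.trans (h.trans hU))]
    exact Submodule.smul_mem_smul (Ideal.mem_span_singleton_self _) trivial

lemma mem_secondFiltration (hz : IsLocalParameter n V z) (hU : U ≤ V) (i : ℕ) (m : Γ(M, U))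
    (hm : ringRes hU z ^ i • m = 0) : m ∈ (secondFiltration M i).obj U := by
  refine mem_annihilated_iff.mpr fun W h a ha ↦ ?_
  rw [hz.pow_ideal_eq W (h.trans hU), Ideal.mem_span_singleton'] at ha
  obtain ⟨b, rfl⟩ := ha
  rw [mul_smul, ← ringRes_ringRes hU h, ← map_pow, ← secRes_smul, hm, map_zero, smul_zero]

lemma exists_idealPow_val_eq (hz : IsLocalParameter n V z) (k : ℕ) (hU : U ≤ V) :
    ∃ s : Γ(idealPow Y k, U), idealPow.val s = ringRes hU z ^ k := by
  refine Subsheaf.exists_ι_app_eq (firstFiltration (structureSheaf Y) k)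
    (s := (ringRes hU z ^ k : Γ(Y, U))) ((hz.mem_firstFiltration_iff hU k _).mpr fun x hx ↦ ?_)
  exact ⟨U, le_rfl, (1 : Γ(Y, U)), hx,
    (ringRes_self le_rfl (ringRes hU z ^ k)).trans (mul_one _).symm⟩

/-- The section `z ^ k` of `𝓘_C ^ k`. -/
def gen (hz : IsLocalParameter n V z) (k : ℕ) (hU : U ≤ V) : Γ(idealPow Y k, U) :=
  (hz.exists_idealPow_val_eq k hU).choose

lemma val_gen (hz : IsLocalParameter n V z) (k : ℕ) (hU : U ≤ V) :
    idealPow.val (hz.gen k hU) = ringRes hU z ^ k :=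
  (hz.exists_idealPow_val_eq k hU).choose_spec

lemma secRes_gen (hz : IsLocalParameter n V z) (k : ℕ) (hU : U ≤ V) (h : W ≤ U) :
    secRes h (hz.gen k hU) = hz.gen k (h.trans hU) := by
  apply idealPow.val_injective
  rw [idealPow.val_secRes, hz.val_gen, hz.val_gen, map_pow, ringRes_ringRes]

lemma exists_local_eq_smul_gen (hz : IsLocalParameter n V z) (k : ℕ) (hU : U ≤ V)
    (s : Γ(idealPow Y k, U)) {x : Y} (hx : x ∈ U) :
    ∃ (W : Y.Opens) (h : W ≤ U) (c : Γ(Y, W)), x ∈ W ∧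
      secRes h s = c • hz.gen k (h.trans hU) := by
  obtain ⟨W, h, c, hxW, e⟩ := (hz.mem_firstFiltration_iff hU k _).mp
    ((firstFiltration (structureSheaf Y) k).ι_app_mem s) x hx
  let c : Γ(Y, W) := c
  refine ⟨W, h, c, hxW, idealPow.val_injective ?_⟩
  rw [idealPow.val_smul, hz.val_gen, mul_comm]
  exact e

lemma exists_local_eq_tmul_gen (hz : IsLocalParameter n V z) (k : ℕ) (hU : U ≤ V)
    (t : Γ(tensor M (idealPow Y k), U)) {x : Y} (hx : x ∈ U) :
    ∃ (W : Y.Opens) (h : W ≤ U) (m : Γ(M, W)), x ∈ W ∧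
      secRes h t = tmul m (hz.gen k (h.trans hU)) := by
  obtain ⟨U', h', y, hxU', e⟩ := exists_local_toTensor_eq t hx
  suffices ∃ (W : Y.Opens) (h : W ≤ U') (m : Γ(M, W)), x ∈ W ∧
      secRes h (toTensor M (idealPow Y k) U' y) = tmul m (hz.gen k (h.trans (h'.trans hU))) by
    obtain ⟨W, h, m, hxW, e'⟩ := this
    exact ⟨W, h.trans h', m, hxW, by rw [← secRes_secRes h' h, ← e, e']⟩
  clear e
  induction y using TensorProduct.induction_on with
  | zero => exact ⟨U', le_rfl, 0, hxU', by rw [map_zero, map_zero, zero_tmul]⟩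
  | tmul m s =>
    obtain ⟨W, h, c, hxW, e⟩ := hz.exists_local_eq_smul_gen k (h'.trans hU) s hxU'
    exact ⟨W, h, c • secRes h m, hxW, by rw [toTensor_tmul, secRes_tmul, e, tmul_smul]⟩
  | add y₁ y₂ ih₁ ih₂ =>
    obtain ⟨W₁, h₁, m₁, hx₁, e₁⟩ := ih₁
    obtain ⟨W₂, h₂, m₂, hx₂, e₂⟩ := ih₂
    refine ⟨W₁ ⊓ W₂, inf_le_left.trans h₁, secRes inf_le_left m₁ + secRes inf_le_right m₂,
      ⟨hx₁, hx₂⟩, ?_⟩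
    rw [map_add, map_add, add_tmul, ← secRes_secRes h₁ inf_le_left, e₁, secRes_tmul,
      ← secRes_secRes h₂ inf_le_right, e₂, secRes_tmul, hz.secRes_gen, hz.secRes_gen]

end IsLocalParameter

end LocalParameter

section Frames

variable {Y : Scheme.{u}} {M N : Y.Modules} {U V : Y.Opens} {i : ℕ}

/-- A finite family of sections of `M` on `U` is a frame modulo `𝓘_C ^ i` if it locally generates
`M` and its relations have coefficients in `𝓘_C ^ i`. -/
structure IsFrame (i : ℕ) {ι : Type} [Fintype ι] (f : ι → Γ(M, U)) : Prop where
  exists_local_eq {W : Y.Opens} (h : W ≤ U) (s : Γ(M, W)) {x : Y} (hx : x ∈ W) :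
    ∃ (W' : Y.Opens) (h' : W' ≤ W) (c : ι → Γ(Y, W')), x ∈ W' ∧
      secRes h' s = ∑ j, c j • secRes (h'.trans h) (f j)
  mem_of_sum_eq_zero {W : Y.Opens} (h : W ≤ U) (c : ι → Γ(Y, W))
    (hc : ∑ j, c j • secRes h (f j) = 0) (j : ι) :
    c j ∈ (firstFiltration (structureSheaf Y) i).obj W

/-- `M` has a frame modulo `𝓘_C ^ i` on `U`. -/
def HasFrame (i : ℕ) (M : Y.Modules) (U : Y.Opens) : Prop :=
  ∃ (ι : Type) (_ : Fintype ι) (f : ι → Γ(M, U)), IsFrame i f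

/-- `M` has frames modulo `𝓘_C ^ i` locally; for `M = a 𝒪_n ⊕ b 𝒪_k` this holds with `i = k`, and
for vector bundles with every `i`. -/
def HasLocalFrames (i : ℕ) (M : Y.Modules) : Prop :=
  ∀ x : Y, ∃ U : Y.Opens, x ∈ U ∧ HasFrame i M U

lemma HasFrame.mono (hM : HasFrame i M U) (h : V ≤ U) : HasFrame i M V := by
  obtain ⟨ι, _, f, hf⟩ := hM
  refine ⟨ι, _, fun j ↦ secRes h (f j), fun h₁ s x hx ↦ ?_, fun h₁ c hc ↦ ?_⟩
  · simpa only [secRes_secRes] using hf.exists_local_eq (h₁.trans h) s hx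
  · simp only [secRes_secRes] at hc
    exact hf.mem_of_sum_eq_zero (h₁.trans h) c hc

lemma exists_opens_of_finite {ι : Type*} [Finite ι] {x : Y} (hx : x ∈ U)
    (P : ι → ∀ V : Y.Opens, V ≤ U → Prop)
    (mono : ∀ j V (hV : V ≤ U) W (hW : W ≤ V), P j V hV → P j W (hW.trans hV))
    (h : ∀ j, ∃ (V : Y.Opens) (hV : V ≤ U), x ∈ V ∧ P j V hV) :
    ∃ (V : Y.Opens) (hV : V ≤ U), x ∈ V ∧ ∀ j, P j V hV := by
  choose V hVU hxV hPV using h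
  refine ⟨U ⊓ ⨅ j, V j, inf_le_left, ⟨hx, ?_⟩, fun j ↦
    mono j (V j) (hVU j) _ (inf_le_right.trans (iInf_le V j)) (hPV j)⟩
  rw [Opens.coe_iInf]
  exact Set.mem_iInter.mpr hxV

section Restriction

/-- The map on the sections over an open subset of `U` induced by a morphism of restrictions
to `U`. -/
def restrictApp (f : M.restrict U.ι ⟶ N.restrict U.ι) (W : (U : Scheme.{u}).Opens) :
    Γ(M, U.ι ''ᵁ W) →ₗ[Γ(Y, U.ι ''ᵁ W)] Γ(N, U.ι ''ᵁ W) where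
  toFun := f.app W
  map_add' := map_add (f.app W).hom
  map_smul' a s := by
    let g : Γ(M, U.ι ''ᵁ W) → Γ(N, U.ι ''ᵁ W) := f.app W
    have inv_hom : (U.ι.appIso W).inv ((U.ι.appIso W).hom a) = a :=
      congr($((U.ι.appIso W).hom_inv_id) a)
    have g_smul : g ((U.ι.appIso W).inv ((U.ι.appIso W).hom a) • s) =
        (U.ι.appIso W).inv ((U.ι.appIso W).hom a) • g s :=
      f.app_smul (U := W) ((U.ι.appIso W).hom a) _
    rwa [inv_hom] at g_smul

lemma restrictApp_secRes (f : M.restrict U.ι ⟶ N.restrict U.ι) {W W' : (U : Scheme.{u}).Opens}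
    (h : U.ι ''ᵁ W' ≤ U.ι ''ᵁ W) (s : Γ(M, U.ι ''ᵁ W)) :
    restrictApp f W' (secRes h s) = secRes h (restrictApp f W s) :=
  app_secRes f ((U.ι.image_le_image_iff _ _).mp h) (show Γ(M.restrict U.ι, W) from s)

lemma restrictApp_hom_inv (e : M.restrict U.ι ≅ N.restrict U.ι) (W : (U : Scheme.{u}).Opens)
    (s : Γ(M, U.ι ''ᵁ W)) : restrictApp e.inv W (restrictApp e.hom W s) = s :=
  congr(($e.hom_inv_id).app W s)

lemma exists_ι_image_eq (h : V ≤ U.ι ''ᵁ ⊤) :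
    ∃ W : (U : Scheme.{u}).Opens, U.ι ''ᵁ W = V :=
  ⟨U.ι ⁻¹ᵁ V, by
    rw [U.ι.image_preimage_eq_opensRange_inf, ← U.ι.image_top_eq_opensRange, inf_eq_right.mpr h]⟩

lemma HasFrame.of_restrict_iso (hM : HasFrame i M (U.ι ''ᵁ ⊤))
    (e : M.restrict U.ι ≅ N.restrict U.ι) : HasFrame i N (U.ι ''ᵁ ⊤) := by
  obtain ⟨ι, _, f, hf⟩ := hM
  refine ⟨ι, _, fun j ↦ restrictApp e.hom ⊤ (f j), fun {W} h s x hx ↦ ?_, fun {W} h c hc ↦ ?_⟩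
  · obtain ⟨W, rfl⟩ := exists_ι_image_eq h
    obtain ⟨W', h', c, hxW', hc⟩ := hf.exists_local_eq h (restrictApp e.inv W s) hx
    obtain ⟨W', rfl⟩ := exists_ι_image_eq (h'.trans h)
    refine ⟨_, h', c, hxW', ?_⟩
    have := congrArg (restrictApp e.hom W') hc
    have hom_inv : restrictApp e.hom W (restrictApp e.inv W s) = s := restrictApp_hom_inv e.symm W s
    simpa only [restrictApp_secRes, map_sum, map_smul, hom_inv] using this
  · obtain ⟨W, rfl⟩ := exists_ι_image_eq h
    refine hf.mem_of_sum_eq_zero h c ?_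
    have := congrArg (restrictApp e.inv W) hc
    simpa only [← restrictApp_secRes, map_sum, map_smul, restrictApp_hom_inv, map_zero] using this

lemma LocallyIsomorphic.hasLocalFrames (h : LocallyIsomorphic M N) (hN : HasFrame i N ⊤) :
    HasLocalFrames i M := by
  intro x
  obtain ⟨U, hx, ⟨e⟩⟩ := h x
  exact ⟨U.ι ''ᵁ ⊤, by rwa [U.ι_image_top], (hN.mono le_top).of_restrict_iso e.symm⟩

lemma HasFrame.of_iso (hM : HasFrame i M U) (e : M ≅ N) : HasFrame i N U := by
  have hM' : HasFrame i M (U.ι ''ᵁ ⊤) := hM.mono U.ι_image_top.le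
  exact (hM'.of_restrict_iso ((Scheme.Modules.restrictFunctor U.ι).mapIso e)).mono
    U.ι_image_top.ge

end Restriction

section DirectSum

attribute [local instance] Abelian.hasFiniteBiproducts

lemma sum_app_apply {α : Type*} (f : α → (M ⟶ N)) (A : Finset α) (s : Γ(M, U)) :
    (∑ a ∈ A, f a).app U s = ∑ a ∈ A, (f a).app U s :=
  map_sum (⟨⟨fun g ↦ g.app U s, rfl⟩, fun _ _ ↦ rfl⟩ : (M ⟶ N) →+ Γ(N, U)) f A

lemma HasFrame.of_isBilimit {α : Type} [Finite α] {X : α → Y.Modules} {b : Bicone X}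
    (hb : b.IsBilimit) (hX : ∀ a, HasFrame i (X a) U) : HasFrame i b.pt U := by
  classical
  cases nonempty_fintype α
  choose ι hι f hf using hX
  refine ⟨Σ a, ι a, inferInstance, fun j ↦ (b.ι j.1).app U (f j.1 j.2),
    fun {W} h s x hx ↦ ?_, fun {W} h c hc ⟨a, j⟩ ↦ ?_⟩
  · obtain ⟨W', h', hxW', coord⟩ := exists_opens_of_finite hx
      (fun a W' h' ↦ ∃ c : ι a → Γ(Y, W'), secRes h' ((b.π a).app W s) =
        ∑ j, c j • secRes (h'.trans h) (f a j))
      (fun a V hV V' hV' ⟨c, hc⟩ ↦ ⟨fun j ↦ ringRes hV' (c j), by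
        simp only [← secRes_secRes hV hV', hc, map_sum, secRes_smul]
        simp only [secRes_secRes]⟩)
      (fun a ↦ by
        obtain ⟨W', h', c, hxW', hc⟩ := (hf a).exists_local_eq h ((b.π a).app W s) hx
        exact ⟨W', h', hxW', c, hc⟩)
    choose c hc using coord
    refine ⟨W', h', fun j ↦ c j.1 j.2, hxW', ?_⟩
    calc
      secRes h' s = (∑ a, b.π a ≫ b.ι a).app W' (secRes h' s) := by
        rw [IsBilimit.total hb]; rfl
      _ = ∑ j : Σ a, ι a, c j.1 j.2 • secRes (h'.trans h) ((b.ι j.1).app U (f j.1 j.2)) := by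
        simp only [sum_app_apply, comp_app_apply, ← app_secRes, Fintype.sum_sigma]
        simp only [app_secRes (b.π _), hc, map_sum, Scheme.Modules.Hom.app_smul]
  · refine (hf a).mem_of_sum_eq_zero h (fun j ↦ c ⟨a, j⟩) ?_ j
    have π_ι (a' : α) (m : Γ(X a', W)) : (b.π a).app W ((b.ι a').app W m) =
        if h : a' = a then h ▸ m else 0 := by
      rw [← comp_app_apply, b.ι_π]
      split_ifs with h
      · subst h; rfl
      · rfl
    have := congrArg ((b.π a).app W) hc
    simp only [map_zero, map_sum, Fintype.sum_sigma, Scheme.Modules.Hom.app_smul,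
      ← app_secRes, π_ι] at this
    rw [Finset.sum_eq_single a (by simp +contextual) (by simp)] at this
    simpa using this

lemma HasFrame.sigma {α : Type} [Finite α] {X : α → Y.Modules} (hX : ∀ a, HasFrame i (X a) U) :
    HasFrame i (∐ X) U :=
  (HasFrame.of_isBilimit (biproduct.isBilimit X) hX).of_iso (biproduct.isoCoproduct X)

lemma HasFrame.coprod (hM : HasFrame i M U) (hN : HasFrame i N U) : HasFrame i (M ⨿ N) U :=
  (HasFrame.of_isBilimit
    ((BinaryBicone.toBiconeIsBilimit _).symm (BinaryBiproduct.isBilimit M N))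
    (by rintro (_ | _); exacts [hM, hN])).of_iso (biprod.isoCoprod M N)

end DirectSum

section Models

lemma hasFrame_of_epi (q : structureSheaf Y ⟶ M) [Epi q]
    (hq : ∀ {W : Y.Opens} (c : Γ(structureSheaf Y, W)), q.app W c = 0 →
      c ∈ (firstFiltration (structureSheaf Y) i).obj W) : HasFrame i M ⊤ := by
  let one : Γ(structureSheaf Y, ⊤) := (1 : Γ(Y, ⊤))
  have smul_q_one {W : Y.Opens} (h : W ≤ ⊤) (c : Γ(Y, W)) :
      c • secRes h (q.app ⊤ one) = q.app W c := by
    have ringRes_one : ringRes h (1 : Γ(Y, ⊤)) = 1 := map_one _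
    rw [← app_secRes, ← Scheme.Modules.Hom.app_smul]
    exact congrArg (q.app W) ((congrArg (c * ·) ringRes_one).trans (mul_one c))
  refine ⟨Unit, inferInstance, fun _ ↦ q.app ⊤ one, fun {W} h s x hx ↦ ?_, fun {W} h c hc j ↦ ?_⟩
  · obtain ⟨W', h', c, hxW', e⟩ := exists_local_preimage q s hx
    let c : Γ(Y, W') := c
    exact ⟨W', h', fun _ ↦ c, hxW', by rw [Fintype.sum_unique, smul_q_one, ← e]⟩
  · rw [Fintype.sum_unique, smul_q_one] at hc
    exact hq _ hc

lemma hasFrame_structureSheaf : HasFrame i (structureSheaf Y) ⊤ :=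
  hasFrame_of_epi (𝟙 _) fun c hc ↦ by
    have : c = 0 := hc
    exact this ▸ zero_mem _

lemma hasFrame_restrictTo : HasFrame i (restrictTo (structureSheaf Y) i) ⊤ :=
  hasFrame_of_epi (toRestrict _ i) fun _ ↦ toRestrict_app_eq_zero_iff.mp

lemma hasFrame_quasiFreeModel (a b k : ℕ) : HasFrame k (quasiFreeModel Y a b k) ⊤ :=
  (HasFrame.sigma fun _ ↦ hasFrame_structureSheaf).coprod
    (HasFrame.sigma fun _ ↦ hasFrame_restrictTo)

lemma IsVectorBundle.hasLocalFrames (h : IsVectorBundle M) (i : ℕ) : HasLocalFrames i M := by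
  intro x
  obtain ⟨U, r, hx, ⟨e⟩⟩ := h x
  have hfree : HasFrame i (∐ fun _ : Fin r ↦ structureSheaf Y) ⊤ :=
    HasFrame.sigma fun _ ↦ hasFrame_structureSheaf
  exact ⟨U.ι ''ᵁ ⊤, by rwa [U.ι_image_top], (hfree.mono le_top).of_restrict_iso e.symm⟩

end Models

end Frames

section KernelOfFrames

variable {Y : Scheme.{u}} {E F M : Y.Modules} {n k : ℕ} {V U W : Y.Opens} {z : Γ(Y, V)}

lemma smul_mem_firstFiltration {c : Γ(Y, U)}
    (hc : c ∈ (firstFiltration (structureSheaf Y) k).obj U) (m : Γ(M, U)) :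
    c • m ∈ (firstFiltration M k).obj U := by
  obtain ⟨s, rfl⟩ := Subsheaf.exists_ι_app_eq _ hc
  exact idealPow.val_smul_mem_firstFiltration s m

lemma mem_firstFiltration_one_of_app_eq_zero {φ : E ⟶ F}
    {ψ : restrictTo E 1 ≅ restrictTo F 1} (hψ : toRestrict E 1 ≫ ψ.hom = φ ≫ toRestrict F 1)
    {m : Γ(E, W)} (hm : φ.app W m = 0) : m ∈ (firstFiltration E 1).obj W := by
  refine toRestrict_app_eq_zero_iff.mp (app_injective_of_mono ψ.hom W ?_)
  rw [← comp_app_apply, hψ, comp_app_apply, hm, map_zero, map_zero]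

namespace IsLocalParameter

lemma eq_zero_of_mem_firstFiltration (hz : IsLocalParameter n V z) (hU : U ≤ V) {m : Γ(M, U)}
    (hm : m ∈ (firstFiltration M n).obj U) : m = 0 := by
  refine eq_of_local _ _ fun x hx ↦ ?_
  obtain ⟨W, h, m', hxW, e⟩ := (hz.mem_firstFiltration_iff hU n m).mp hm x hx
  exact ⟨W, h, hxW, by rw [e, ← map_pow, hz.pow_eq_zero, map_zero, zero_smul, map_zero]⟩

lemma mem_firstFiltration_structureSheaf_of_pow_mul_eq_zero (hz : IsLocalParameter n V z)
    (hk : k ≤ n) (hU : U ≤ V) {c : Γ(Y, U)} (hc : ringRes hU z ^ k * c = 0) :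
    c ∈ (firstFiltration (structureSheaf Y) (n - k)).obj U := by
  refine (hz.mem_firstFiltration_iff hU _ _).mpr fun x hx ↦ ?_
  obtain ⟨W, hxW, h⟩ := exists_affine Y hx
  obtain ⟨d, hd⟩ := hz.dvd_of_pow_mul_eq_zero W (h.trans hU) k hk (ringRes h c) (by
    rw [← ringRes_ringRes hU h, ← map_pow, ← map_mul, hc, map_zero])
  exact ⟨W.1, h, d, hxW, hd⟩

lemma mem_firstFiltration_of_pow_smul_eq_zero (hz : IsLocalParameter n V z)
    (hM : HasLocalFrames n M) (hk : k ≤ n) (hW : W ≤ V) {m : Γ(M, W)}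
    (hm : ringRes hW z ^ k • m = 0) : m ∈ (firstFiltration M (n - k)).obj W := by
  refine (firstFiltration M (n - k)).local_mem fun x hx ↦ ?_
  obtain ⟨U, hxU, ι, _, f, hf⟩ := hM x
  obtain ⟨W', h, c, hxW', hc⟩ := hf.exists_local_eq (W := W ⊓ U) inf_le_right
    (secRes inf_le_left m) ⟨hx, hxU⟩
  rw [secRes_secRes] at hc
  have hW' : W' ≤ V := h.trans (inf_le_left.trans hW)
  have relation : ∑ j, (ringRes hW' z ^ k * c j) • secRes (h.trans inf_le_right) (f j) = 0 := by
    simp only [mul_smul, ← Finset.smul_sum]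
    rw [← hc, ← ringRes_ringRes hW (h.trans inf_le_left), ← map_pow, ← secRes_smul, hm, map_zero]
  have coeff_eq_zero (j : ι) : ringRes hW' z ^ k * c j = 0 :=
    hz.eq_zero_of_mem_firstFiltration (M := structureSheaf Y) hW'
      (hf.mem_of_sum_eq_zero _ _ relation j)
  refine ⟨W', CategoryTheory.homOfLE (h.trans inf_le_left), hxW', ?_⟩
  rw [presheaf_map_apply, hc]
  exact sum_mem fun j _ ↦ smul_mem_firstFiltration
    (hz.mem_firstFiltration_structureSheaf_of_pow_mul_eq_zero hk hW' (coeff_eq_zero j)) _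

-- Nakayama's lemma for the nilpotent ideal `𝓘_C`.
lemma exists_local_eq_sum_of_exists_local_sub_mem (hz : IsLocalParameter n V z) (hU : U ≤ V)
    {ι : Type} [Fintype ι] {e : ι → Γ(M, U)}
    (he : ∀ {A : Y.Opens} (hA : A ≤ U) (m : Γ(M, A)) {x : Y}, x ∈ A →
      ∃ (B : Y.Opens) (hB : B ≤ A) (b : ι → Γ(Y, B)), x ∈ B ∧
        secRes hB m - ∑ j, b j • secRes (hB.trans hA) (e j) ∈ (firstFiltration M 1).obj B)
    (m : Γ(M, U)) {x : Y} (hx : x ∈ U) :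
    ∃ (B : Y.Opens) (hB : B ≤ U) (b : ι → Γ(Y, B)), x ∈ B ∧
      secRes hB m = ∑ j, b j • secRes hB (e j) := by
  suffices ∀ t, ∃ (B : Y.Opens) (hB : B ≤ U) (b : ι → Γ(Y, B)) (m' : Γ(M, B)), x ∈ B ∧
      secRes hB m = ∑ j, b j • secRes hB (e j) + ringRes (hB.trans hU) z ^ t • m' by
    obtain ⟨B, hB, b, m', hxB, h⟩ := this n
    exact ⟨B, hB, b, hxB, by
      rw [h, ← map_pow, hz.pow_eq_zero, map_zero, zero_smul, add_zero]⟩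
  intro t
  induction t with
  | zero => exact ⟨U, le_rfl, 0, m, hx, by simp⟩
  | succ t ih =>
    obtain ⟨A, hA, a, m', hxA, hm⟩ := ih
    obtain ⟨B, hB, b, hxB, hm'⟩ := he hA m' hxA
    obtain ⟨B', hB', m'', hxB', e''⟩ :=
      (hz.mem_firstFiltration_iff (hB.trans (hA.trans hU)) 1 _).mp hm' x hxB
    have hBA : B' ≤ A := hB'.trans hB
    refine ⟨B', hBA.trans hA, fun j ↦ ringRes hBA (a j) +
      ringRes (hBA.trans (hA.trans hU)) z ^ t * ringRes hB' (b j), m'', hxB', ?_⟩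
    rw [pow_one, map_sub, sub_eq_iff_eq_add, secRes_secRes] at e''
    rw [← secRes_secRes hA hBA, hm, map_add, secRes_smul, e'']
    simp only [map_sum, secRes_smul, secRes_secRes, map_pow, ringRes_ringRes, add_smul,
      mul_smul, smul_add, Finset.smul_sum, Finset.sum_add_distrib, pow_succ]
    abel

lemma mem_firstFiltration_of_app_eq_zero (hz : IsLocalParameter n V z) {φ : E ⟶ F} [Epi φ]
    (hF : HasLocalFrames k F)
    (hφ : ∀ {A : Y.Opens} {m : Γ(E, A)}, φ.app A m = 0 → m ∈ (firstFiltration E 1).obj A)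
    (hW : W ≤ V) {l : Γ(E, W)} (hl : φ.app W l = 0) : l ∈ (firstFiltration E k).obj W := by
  refine (firstFiltration E k).local_mem fun x hx ↦ ?_
  obtain ⟨U, hxU, ι, _, f, hf⟩ := hF x
  obtain ⟨A, hA, hxA, lift⟩ := exists_opens_of_finite (U := W ⊓ U) ⟨hx, hxU⟩
    (fun j A hA ↦ ∃ e : Γ(E, A), φ.app A e = secRes (hA.trans inf_le_right) (f j))
    (fun j A hA B hB ⟨e, he⟩ ↦ ⟨secRes hB e, by rw [app_secRes, he, secRes_secRes]⟩)
    (fun j ↦ by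
      obtain ⟨A, hA, m, hxA, e⟩ := exists_local_preimage φ
        (secRes (inf_le_right : W ⊓ U ≤ U) (f j)) ⟨hx, hxU⟩
      exact ⟨A, hA, hxA, m, by rw [e, secRes_secRes]⟩)
  choose e he using lift
  have app_sum {B : Y.Opens} (hB : B ≤ A) (b : ι → Γ(Y, B)) :
      φ.app B (∑ j, b j • secRes hB (e j)) =
        ∑ j, b j • secRes (hB.trans (hA.trans inf_le_right)) (f j) := by
    simp only [map_sum, Scheme.Modules.Hom.app_smul, app_secRes, he, secRes_secRes]
  obtain ⟨B, hB, b, hxB, hb⟩ := hz.exists_local_eq_sum_of_exists_local_sub_mem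
    (hA.trans (inf_le_left.trans hW)) (e := e) (fun {A'} hA' m {y} hy ↦ by
      obtain ⟨B, hB, b, hyB, hb⟩ :=
        hf.exists_local_eq (hA'.trans (hA.trans inf_le_right)) (φ.app A' m) hy
      exact ⟨B, hB, b, hyB, hφ (by rw [map_sub, app_secRes, hb, app_sum, sub_self])⟩)
    (secRes (hA.trans inf_le_left) l) hxA
  rw [secRes_secRes] at hb
  have relation := app_sum hB b
  rw [← hb, app_secRes, hl, map_zero] at relation
  refine ⟨B, CategoryTheory.homOfLE (hB.trans (hA.trans inf_le_left)), hxB, ?_⟩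
  rw [presheaf_map_apply, hb]
  exact sum_mem fun j _ ↦ smul_mem_firstFiltration
    (hf.mem_of_sum_eq_zero _ b relation.symm j) _

end IsLocalParameter

end KernelOfFrames

section CanonicalIsomorphism

variable {Y : Scheme.{u}} {E F : Y.Modules} {n k : ℕ} {V U W : Y.Opens} {z : Γ(Y, V)}

namespace IsLocalParameter

lemma app_mem_firstFiltration (hz : IsLocalParameter n V z) (hU : U ≤ V) (f : E ⟶ F)
    {m : Γ(E, U)} (hm : m ∈ (firstFiltration E k).obj U) :
    f.app U m ∈ (firstFiltration F k).obj U := by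
  refine (hz.mem_firstFiltration_iff hU k _).mpr fun x hx ↦ ?_
  obtain ⟨W, h, m', hxW, e⟩ := (hz.mem_firstFiltration_iff hU k m).mp hm x hx
  exact ⟨W, h, f.app W m', hxW, by rw [← app_secRes, e, Scheme.Modules.Hom.app_smul]⟩

variable {φ : E ⟶ F}

lemma app_mem_firstFiltration_of_pow_smul_mem (hz : IsLocalParameter n V z) (hk : k ≤ n)
    (hE : HasLocalFrames n E) (hU : U ≤ V) {v : Γ(E, U)} {l : Γ(kernel φ, U)}
    (hl : (kernel.ι φ).app U l = ringRes hU z ^ k • v)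
    (hlk : l ∈ (firstFiltration (kernel φ) k).obj U) :
    φ.app U v ∈ (firstFiltration F (n - k)).obj U := by
  refine (firstFiltration F (n - k)).local_mem fun x hx ↦ ?_
  obtain ⟨W, h, l', hxW, e⟩ := (hz.mem_firstFiltration_iff hU k l).mp hlk x hx
  have hvl' : secRes h v - (kernel.ι φ).app W l' ∈ (firstFiltration E (n - k)).obj W := by
    refine hz.mem_firstFiltration_of_pow_smul_eq_zero hE hk (h.trans hU) ?_
    rw [smul_sub, ← Scheme.Modules.Hom.app_smul, ← e, app_secRes, hl, secRes_smul, map_pow,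
      ringRes_ringRes, sub_self]
  refine ⟨W, CategoryTheory.homOfLE h, hxW, ?_⟩
  have hφv := hz.app_mem_firstFiltration (h.trans hU) φ hvl'
  rwa [map_sub, app_kernel_ι_app, sub_zero, app_secRes] at hφv

lemma exists_comparisonRel_gen [Epi φ] (hz : IsLocalParameter n V z)
    (hn : Y.nilradical ^ n = ⊥) (hk : k ≤ n) (hF : HasLocalFrames k F)
    (hφ : ∀ {A : Y.Opens} {m : Γ(E, A)}, φ.app A m = 0 → m ∈ (firstFiltration E 1).obj A)
    (hU : U ≤ V) (p : Γ(restrictTo (kernel φ) k, U)) {x : Y} (hx : x ∈ U) :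
    ∃ (W : Y.Opens) (h : W ≤ U) (m : Γ(filtrationQuotient hn hk F, W)), x ∈ W ∧
      ComparisonRel hn hk φ m (hz.gen k (h.trans hU)) (secRes h p) := by
  obtain ⟨A, hA, l, hxA, hl⟩ := exists_local_preimage (toRestrict (kernel φ) k) p hx
  obtain ⟨W, h, v, hxW, hv⟩ := (hz.mem_firstFiltration_iff (hA.trans hU) k _).mp
    (hz.mem_firstFiltration_of_app_eq_zero hF hφ (hA.trans hU) (app_kernel_ι_app φ l)) x hxA
  obtain ⟨u, hu⟩ := (secondFiltration F k).exists_ι_app_eq <|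
    hz.mem_secondFiltration (h.trans (hA.trans hU)) k (φ.app W v) <| by
      rw [← Scheme.Modules.Hom.app_smul, ← hv, ← app_secRes, app_kernel_ι_app]
  refine ⟨W, h.trans hA, _, hxW, u, v, secRes h l, hu.symm, ?_, rfl, ?_⟩
  · rw [app_secRes, hv, hz.val_gen]
  · rw [app_secRes, hl, secRes_secRes]

lemma eq_zero_of_comparisonRel_gen (hz : IsLocalParameter n V z) {hn : Y.nilradical ^ n = ⊥}
    {hk : k ≤ n} (hE : HasLocalFrames n E) (hU : U ≤ V) {m : Γ(filtrationQuotient hn hk F, U)}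
    (hm : ComparisonRel hn hk φ m (hz.gen k hU) 0) : m = 0 := by
  obtain ⟨u, v, l, hv, hl, rfl, hl_eq_zero⟩ := hm
  rw [hz.val_gen] at hl
  rw [toFiltrationQuotient_app_eq_zero_iff, ← hv]
  exact hz.app_mem_firstFiltration_of_pow_smul_mem hk hE hU hl
    (toRestrict_app_eq_zero_iff.mp hl_eq_zero)

end IsLocalParameter

variable {φ : E ⟶ F} [Epi φ] (hn : Y.nilradical ^ n = ⊥) (hk : k ≤ n)

lemma mono_comparisonHom (hY : HasLocalParameters Y n) (hE : HasLocalFrames n E) :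
    Mono (comparisonHom hn hk φ) := by
  refine mono_of_app_injective _ fun U ↦ (injective_iff_map_eq_zero _).mpr fun t ht ↦
    eq_of_local _ _ fun x hx ↦ ?_
  obtain ⟨V, z, hxV, hz⟩ := hY x
  obtain ⟨A, hA, m, hxA, htm⟩ := hz.exists_local_eq_tmul_gen k (U := U ⊓ V) inf_le_right
    (secRes inf_le_left t) ⟨hx, hxV⟩
  have hAV : A ≤ V := hA.trans inf_le_right
  have comparison_eq_zero : comparisonSection hn hk φ m (hz.gen k hAV) = 0 := by
    rw [← comparisonHom_app_tmul, ← htm, app_secRes, app_secRes, ht, map_zero, map_zero]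
  obtain ⟨W, hWA, hxW, hrel⟩ := exists_local_comparisonRel (φ := φ) m (hz.gen k hAV) hxA
  rw [comparison_eq_zero, map_zero, hz.secRes_gen] at hrel
  refine ⟨W, hWA.trans (hA.trans inf_le_left), hxW, ?_⟩
  rw [map_zero, ← secRes_secRes inf_le_left (hWA.trans hA), ← secRes_secRes hA hWA, htm,
    secRes_tmul, hz.eq_zero_of_comparisonRel_gen hE _ hrel, zero_tmul]

lemma epi_comparisonHom (hY : HasLocalParameters Y n) (hF : HasLocalFrames k F)
    (hφ : ∀ {A : Y.Opens} {m : Γ(E, A)}, φ.app A m = 0 → m ∈ (firstFiltration E 1).obj A) :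
    Epi (comparisonHom hn hk φ) := by
  refine epi_of_local_preimage _ fun U p x hx ↦ ?_
  obtain ⟨V, z, hxV, hz⟩ := hY x
  obtain ⟨W, h, m, hxW, hm⟩ := hz.exists_comparisonRel_gen hn hk hF hφ (U := U ⊓ V) inf_le_right
    (secRes inf_le_left p) ⟨hx, hxV⟩
  exact ⟨W, h.trans inf_le_left, _, hxW, by rw [comparisonHom_app_tmul_of_rel hm, secRes_secRes]⟩

end CanonicalIsomorphism

section SmoothAlgebras

open KaehlerDifferential

/-- A local form of smoothness of relative dimension `p`, meant for the local rings of a smooth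
scheme: the `K`-algebra `A` is formally smooth and `Ω[A⁄K]` is free of rank `p`. -/
structure IsFormallySmoothOfRank (K A : Type*) [CommRing K] [CommRing A] [Algebra K A]
    (p : ℕ) : Prop where
  formallySmooth : Algebra.FormallySmooth K A
  free : Module.Free A Ω[A⁄K]
  finite : Module.Finite A Ω[A⁄K]
  finrank_eq : Module.finrank A Ω[A⁄K] = p

lemma IsFormallySmoothOfRank.of_bijective {K A : Type*} [CommRing K] [CommRing A] [Nontrivial A]
    [Algebra K A] (h : Function.Bijective (algebraMap K A)) : IsFormallySmoothOfRank K A 0 := by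
  have := KaehlerDifferential.subsingleton_of_surjective K A h.2
  exact ⟨.of_equiv (AlgEquiv.ofBijective (Algebra.ofId K A) h), inferInstance, inferInstance,
    Module.finrank_zero_of_subsingleton⟩

lemma IsFormallySmoothOfRank.of_isLocalization {K B S : Type*} [CommRing K] [CommRing B]
    [CommRing S] [Nontrivial S] [Algebra K B] [Algebra B S] [Algebra K S] [IsScalarTower K B S]
    (M : Submonoid B) [IsLocalization M S] {p : ℕ}
    (h : Algebra.IsStandardSmoothOfRelativeDimension p K B) : IsFormallySmoothOfRank K S p := by
  have : Nontrivial B := (algebraMap B S).domain_nontrivial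
  have := h.isStandardSmooth
  have : Algebra.FormallyEtale B S := .of_isLocalization M
  let e := tensorKaehlerEquivOfFormallyEtale K B S
  refine ⟨.comp K B S, .of_equiv e, .equiv e, ?_⟩
  rw [← e.finrank_eq, Module.finrank_baseChange]
  exact Module.finrank_eq_of_rank_eq
    (Algebra.IsStandardSmoothOfRelativeDimension.rank_kaehlerDifferential (R := K) (S := B) p)

lemma exists_ker_eq_span_singleton_of_finrank_eq {R M P : Type*} [CommRing R] [IsLocalRing R]
    [AddCommGroup M] [AddCommGroup P] [Module R M] [Module R P] [Module.Free R M]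
    [Module.Finite R M] [Module.Free R P] [Module.Finite R P] {g : M →ₗ[R] P}
    (hg : Function.Surjective g) (h : Module.finrank R M = Module.finrank R P + 1) :
    ∃ v ≠ 0, LinearMap.ker g = Submodule.span R {v} := by
  obtain ⟨r, hr⟩ := Module.projective_lifting_property g LinearMap.id hg
  let N := LinearMap.ker g
  let e : M ≃ₗ[R] N × P := ((LinearMap.exact_subtype_ker_map g).splitSurjectiveEquiv
    (LinearMap.ker g).injective_subtype ⟨r, hr⟩).1
  have : Module.Finite R N := .of_surjective (LinearMap.fst R N P ∘ₗ e.toLinearMap)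
    ((LinearMap.fst_surjective (R := R)).comp e.surjective)
  have : Module.Projective R N := .of_split (e.symm.toLinearMap ∘ₗ LinearMap.inl R N P)
    (LinearMap.fst R N P ∘ₗ e.toLinearMap) (by ext x; simp)
  have : Module.Free R N := Module.free_of_flat_of_isLocalRing
  have hrank : Module.finrank R N = 1 := by
    have := e.finrank_eq
    rw [Module.finrank_prod] at this
    omega
  obtain ⟨v, hv0, hv⟩ := finrank_eq_one_iff'.mp hrank
  refine ⟨v.1, fun h0 ↦ hv0 (Subtype.ext h0), le_antisymm (fun w hw ↦ ?_) ?_⟩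
  · obtain ⟨c, hc⟩ := hv ⟨w, hw⟩
    exact Submodule.mem_span_singleton.mpr ⟨c, congr_arg Subtype.val hc⟩
  · exact (Submodule.span_singleton_le_iff_mem _ _).mpr v.2

lemma eq_span_singleton_of_forall_smul_toCotangent {A : Type*} [CommRing A] [IsLocalRing A]
    {I : Ideal A} (hfg : I.FG) (hI : I ≠ ⊤) (f : I)
    (h : ∀ w : I, ∃ a : A, a • I.toCotangent f = I.toCotangent w) : I = Ideal.span {f.1} := by
  refine le_antisymm (Submodule.le_of_le_smul_of_le_jacobson_bot (I := I) hfg ?_ fun w hw ↦ ?_)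
    ((Ideal.span_singleton_le_iff_mem _).mpr f.2)
  · rw [IsLocalRing.jacobson_eq_maximalIdeal _ bot_ne_top]
    exact IsLocalRing.le_maximalIdeal hI
  · obtain ⟨a, ha⟩ := h ⟨w, hw⟩
    have hsq : w - a * f.1 ∈ I ^ 2 := by
      rw [← map_smul, eq_comm, I.toCotangent_eq] at ha
      exact ha
    refine Submodule.mem_sup.mpr ⟨a * f.1, Ideal.mul_mem_left _ _
      (Ideal.mem_span_singleton_self _), _, ?_, add_sub_cancel _ _⟩
    rwa [smul_eq_mul, ← pow_two]

variable {K A D : Type*} [CommRing K] [CommRing A] [CommRing D] [Algebra K A] [Algebra K D]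
  [Algebra A D] [IsScalarTower K A D]

lemma kerCotangentToTensor_injective [Algebra.FormallySmooth K A] [Algebra.FormallySmooth K D]
    (h : Function.Surjective (algebraMap A D)) :
    Function.Injective (kerCotangentToTensor K A D) := by
  obtain ⟨l, hl⟩ := (Algebra.FormallySmooth.iff_split_injection (R := K) h).mp inferInstance
  exact Function.LeftInverse.injective (g := l) fun x ↦ LinearMap.congr_fun hl x

lemma IsFormallySmoothOfRank.exists_ker_eq_span_singleton [IsLocalRing A] [IsNoetherianRing A]
    [IsLocalRing D] {p : ℕ} (hAD : Function.Surjective (algebraMap A D))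
    (hA : IsFormallySmoothOfRank K A (p + 1)) (hD : IsFormallySmoothOfRank K D p) :
    ∃ f ≠ 0, RingHom.ker (algebraMap A D) = Ideal.span {f} := by
  obtain ⟨_, _, _, hA⟩ := hA
  obtain ⟨_, _, _, hD⟩ := hD
  have hinj := kerCotangentToTensor_injective (K := K) hAD
  obtain ⟨v, hv0, hker⟩ := exists_ker_eq_span_singleton_of_finrank_eq
    (mapBaseChange_surjective K A D hAD) (by rw [Module.finrank_baseChange, hA, hD])
  -- The conormal sequence identifies `I / I ^ 2` with the kernel of `D ⊗ Ω[A⁄K] → Ω[D⁄K]`.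
  have hrange := (range_kerCotangentToTensor K A D hAD).trans
    (congr_arg (Submodule.restrictScalars A) hker)
  obtain ⟨f', hf'⟩ : v ∈ LinearMap.range (kerCotangentToTensor K A D) := by
    rw [hrange]
    exact Submodule.mem_span_singleton_self v
  obtain ⟨f, rfl⟩ := Ideal.toCotangent_surjective _ f'
  refine ⟨f.1, fun h0 ↦ hv0 ?_, eq_span_singleton_of_forall_smul_toCotangent
    (IsNoetherian.noetherian _) (RingHom.ker_ne_top _) f fun w ↦ ?_⟩
  · rw [← hf', show f = 0 from Subtype.ext h0, map_zero, map_zero]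
  · have hw : kerCotangentToTensor K A D (Ideal.toCotangent _ w) ∈ Submodule.span D {v} := by
      have := LinearMap.mem_range_self (kerCotangentToTensor K A D) (Ideal.toCotangent _ w)
      rwa [hrange] at this
    obtain ⟨c, hc⟩ := Submodule.mem_span_singleton.mp hw
    obtain ⟨a, rfl⟩ := hAD c
    refine ⟨a, hinj ?_⟩
    rw [map_smul, hf', ← hc, algebraMap_smul]

end SmoothAlgebras

section NilpotentParameter

variable {R : Type*} [CommRing R]

/-- The element `z` generates the nilradical of `R`, and its powers behave like those of the class
of `X` in `S[X] / (X ^ (m + 1))`: this is the property of a local equation of `C` in the local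
rings of a primitive multiple curve of multiplicity `m + 1`. -/
structure IsNilpotentParameter (m : ℕ) (z : R) : Prop where
  nilradical_eq : nilradical R = Ideal.span {z}
  pow_succ_eq_zero : z ^ (m + 1) = 0
  dvd_of_pow_mul_eq_zero {a : R} : z ^ m * a = 0 → z ∣ a

namespace IsNilpotentParameter

variable {m : ℕ} {z : R}

lemma pow_ne_zero [Nontrivial R] (h : IsNilpotentParameter m z) : z ^ m ≠ 0 := fun h0 ↦ by
  have hunit : IsUnit z := isUnit_of_dvd_one (h.dvd_of_pow_mul_eq_zero (by rw [h0, zero_mul]))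
  exact not_isUnit_zero (h.pow_succ_eq_zero ▸ hunit.pow (m + 1))

lemma pow_eq_zero_iff [Nontrivial R] (h : IsNilpotentParameter m z) {i : ℕ} :
    z ^ i = 0 ↔ m < i :=
  ⟨fun h0 ↦ not_le.mp fun hi ↦ h.pow_ne_zero (pow_eq_zero_of_le hi h0),
    fun hi ↦ pow_eq_zero_of_le hi h.pow_succ_eq_zero⟩

lemma nilradical_pow_eq_bot_iff [Nontrivial R] (h : IsNilpotentParameter m z) {i : ℕ} :
    nilradical R ^ i = ⊥ ↔ m < i := by
  rw [h.nilradical_eq, Ideal.span_singleton_pow, Ideal.span_singleton_eq_bot, h.pow_eq_zero_iff]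

lemma eq_of_nontrivial [Nontrivial R] (h : IsNilpotentParameter m z) {m' : ℕ} {z' : R}
    (h' : IsNilpotentParameter m' z') : m = m' :=
  eq_of_forall_gt_iff fun _ ↦ h.nilradical_pow_eq_bot_iff.symm.trans h'.nilradical_pow_eq_bot_iff

lemma pow_dvd_of_pow_mul_eq_zero (h : IsNilpotentParameter m z) {k : ℕ} (hk : k ≤ m + 1) {a : R}
    (ha : z ^ k * a = 0) : z ^ (m + 1 - k) ∣ a := by
  suffices ∀ j ≤ m + 1 - k, z ^ j ∣ a from this _ le_rfl
  intro j hj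
  induction j with
  | zero => simp
  | succ j ih =>
    obtain ⟨c, rfl⟩ := ih (by omega)
    refine pow_succ z j ▸ mul_dvd_mul_left _ (h.dvd_of_pow_mul_eq_zero ?_)
    rw [show m = (m - (k + j)) + (k + j) by omega, pow_add, mul_assoc, pow_add, mul_assoc, ha,
      mul_zero]

lemma of_associated (h : IsNilpotentParameter m z) {w : R} (hw : Associated z w) :
    IsNilpotentParameter m w where
  nilradical_eq := h.nilradical_eq.trans <| le_antisymm
    (Ideal.span_singleton_le_span_singleton.mpr hw.symm.dvd)
    (Ideal.span_singleton_le_span_singleton.mpr hw.dvd)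
  pow_succ_eq_zero := (hw.pow_pow (n := m + 1)).eq_zero_iff.mp h.pow_succ_eq_zero
  dvd_of_pow_mul_eq_zero {a} ha := hw.symm.dvd.trans <| h.dvd_of_pow_mul_eq_zero <|
    (hw.pow_pow (n := m)).symm.mul_right a |>.eq_zero_iff.mp ha

end IsNilpotentParameter

section Localization

variable {S : Type*} [CommRing S] [Algebra R S]

lemma map_le_map_of_forall_mul_mem {I J : Ideal R} {s : R} (hs : IsUnit (algebraMap R S s))
    (h : ∀ g ∈ I, s * g ∈ J) :
    I.map (algebraMap R S) ≤ J.map (algebraMap R S) := by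
  refine Ideal.map_le_iff_le_comap.mpr fun g hg ↦ ?_
  rw [Ideal.mem_comap, ← Ideal.unit_mul_mem_iff_mem _ hs, ← map_mul]
  exact Ideal.mem_map_of_mem _ (h g hg)

variable (M : Submonoid R) [IsLocalization M S]

include M

lemma exists_forall_mul_mem_of_map_le_map {I J : Ideal R} (hI : I.FG)
    (h : I.map (algebraMap R S) ≤ J.map (algebraMap R S)) : ∃ s ∈ M, ∀ g ∈ I, s * g ∈ J := by
  classical
  obtain ⟨T, rfl⟩ := hI
  have exists_mul_mem (g : R) (hg : g ∈ T) : ∃ s ∈ M, s * g ∈ J := by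
    obtain ⟨⟨a, s⟩, has⟩ := (IsLocalization.mem_map_algebraMap_iff M S).mp
      (h (Ideal.mem_map_of_mem _ (Ideal.subset_span hg)))
    rw [← map_mul] at has
    obtain ⟨c, hc⟩ := (IsLocalization.eq_iff_exists M S).mp has
    refine ⟨c.1 * s.1, M.mul_mem c.2 s.2, ?_⟩
    rw [mul_assoc, mul_comm s.1, hc]
    exact J.mul_mem_left _ a.2
  choose! s hsM hs using exists_mul_mem
  refine ⟨∏ g ∈ T, s g, prod_mem hsM, fun g hg ↦ ?_⟩
  induction hg using Submodule.span_induction with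
  | mem g hg =>
    rw [← Finset.mul_prod_erase T s hg, mul_right_comm]
    exact J.mul_mem_right _ (hs g hg)
  | zero => simp
  | add x y _ _ hx hy => rw [mul_add]; exact add_mem hx hy
  | smul c x _ hx => rw [smul_eq_mul, mul_left_comm]; exact J.mul_mem_left _ hx

lemma map_ker_mulLeft (a : R) : Ideal.map (algebraMap R S) (LinearMap.ker (LinearMap.mulLeft R a)) =
    LinearMap.ker (LinearMap.mulLeft S (algebraMap R S a)) := by
  refine le_antisymm (Ideal.map_le_iff_le_comap.mpr fun x hx ↦ ?_) fun x hx ↦ ?_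
  · change algebraMap R S a * algebraMap R S x = 0
    rw [← map_mul, show a * x = 0 from hx, map_zero]
  · obtain ⟨⟨b, t⟩, hbt⟩ := IsLocalization.surj M x
    obtain ⟨c, hc⟩ := (IsLocalization.map_eq_zero_iff M S (a * b)).mp (by
      rw [map_mul, ← hbt, ← mul_assoc, show algebraMap R S a * x = 0 from hx, zero_mul])
    refine (IsLocalization.mem_map_algebraMap_iff M S).mpr ⟨⟨⟨c * b, ?_⟩, c * t⟩, ?_⟩
    · rwa [LinearMap.mem_ker, LinearMap.mulLeft_apply, mul_left_comm]
    · rw [Submonoid.coe_mul, map_mul, map_mul, ← hbt, mul_left_comm]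

lemma isNilpotentParameter_algebraMap_iff {m : ℕ} {ζ : R} :
    IsNilpotentParameter m (algebraMap R S ζ) ↔
      (nilradical R).map (algebraMap R S) ≤ (Ideal.span {ζ}).map (algebraMap R S) ∧
      (Ideal.span {ζ ^ (m + 1)}).map (algebraMap R S) ≤ (⊥ : Ideal R).map (algebraMap R S) ∧
      Ideal.map (algebraMap R S) (LinearMap.ker (LinearMap.mulLeft R (ζ ^ m))) ≤
        (Ideal.span {ζ}).map (algebraMap R S) := by
  have hnil : (nilradical R).map (algebraMap R S) = nilradical S := by
    rw [nilradical, IsLocalization.map_radical M, Ideal.zero_eq_bot, Ideal.map_bot]; rfl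
  rw [map_ker_mulLeft M, hnil, Ideal.map_bot, Ideal.map_span, Ideal.map_span, Set.image_singleton,
    Set.image_singleton, map_pow, map_pow, le_bot_iff, Ideal.span_singleton_eq_bot]
  refine ⟨fun h ↦ ⟨h.nilradical_eq.le, h.pow_succ_eq_zero, fun a ha ↦
    Ideal.mem_span_singleton.mpr (h.dvd_of_pow_mul_eq_zero ha)⟩, fun ⟨hle, hpow, hann⟩ ↦
    ⟨le_antisymm hle ?_, hpow, fun ha ↦ Ideal.mem_span_singleton.mp (hann ha)⟩⟩
  exact (Ideal.span_singleton_le_iff_mem _).mpr ⟨m + 1, hpow⟩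

lemma IsNilpotentParameter.exists_forall_localization [IsNoetherianRing R] {m : ℕ} {z : S}
    (h : IsNilpotentParameter m z) :
    ∃ ζ : R, ∃ s ∈ M, ∀ (M' : Submonoid R) (S' : Type*) [CommRing S'] [Algebra R S']
      [IsLocalization M' S'], IsUnit (algebraMap R S' s) →
        IsNilpotentParameter m (algebraMap R S' ζ) := by
  obtain ⟨⟨ζ, t⟩, hζ⟩ := IsLocalization.surj M z
  have hassoc : Associated z (algebraMap R S ζ) := ⟨(IsLocalization.map_units S t).unit, hζ⟩
  obtain ⟨hnil, hpow, hann⟩ :=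
    (isNilpotentParameter_algebraMap_iff M).mp (h.of_associated hassoc)
  obtain ⟨s₁, hs₁, hnil⟩ :=
    exists_forall_mul_mem_of_map_le_map M (IsNoetherian.noetherian _) hnil
  obtain ⟨s₂, hs₂, hpow⟩ :=
    exists_forall_mul_mem_of_map_le_map M (IsNoetherian.noetherian _) hpow
  obtain ⟨s₃, hs₃, hann⟩ :=
    exists_forall_mul_mem_of_map_le_map M (IsNoetherian.noetherian _) hann
  refine ⟨ζ, s₁ * s₂ * s₃, M.mul_mem (M.mul_mem hs₁ hs₂) hs₃, fun M' S' _ _ _ hs ↦ ?_⟩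
  simp only [map_mul, IsUnit.mul_iff] at hs
  exact (isNilpotentParameter_algebraMap_iff M').mpr ⟨map_le_map_of_forall_mul_mem hs.1.1 hnil,
    map_le_map_of_forall_mul_mem hs.1.2 hpow, map_le_map_of_forall_mul_mem hs.2 hann⟩

end Localization

section TwoGenerators

variable {z t τ a : R} {m : ℕ}

lemma pow_mul_pow_ne_zero (hτ : τ ∈ Ideal.span {z, t}) (hreg : IsSMulRegular R τ)
    (hz : z ^ (m + 1) = 0) (hz0 : z ^ m ≠ 0) (j : ℕ) : z ^ m * t ^ j ≠ 0 := fun h0 ↦ by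
  obtain ⟨α, β, rfl⟩ := Ideal.mem_span_pair.mp hτ
  obtain ⟨c, hc⟩ := sub_dvd_pow_sub_pow (α * z + β * t) (β * t) j
  refine hz0 ((hreg.pow j).right_eq_zero_of_smul ?_)
  calc (α * z + β * t) ^ j • z ^ m
      = ((α * z + β * t) ^ j - (β * t) ^ j) * z ^ m + β ^ j * (z ^ m * t ^ j) := by
        rw [smul_eq_mul]; ring
    _ = α * c * z ^ (m + 1) + β ^ j * (z ^ m * t ^ j) := by rw [hc]; ring
    _ = 0 := by rw [hz, h0, mul_zero, mul_zero, add_zero]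

variable [IsLocalRing R]

lemma mem_span_pair_pow_of_pow_mul_eq_zero (hmax : IsLocalRing.maximalIdeal R = Ideal.span {z, t})
    (hz : z ^ (m + 1) = 0) (hzt : ∀ j, z ^ m * t ^ j ≠ 0) (ha : z ^ m * a = 0) (j : ℕ) :
    a ∈ Ideal.span {z, t ^ j} := by
  induction j with
  | zero => exact Ideal.mem_span_pair.mpr ⟨0, a, by ring⟩
  | succ j ih =>
    obtain ⟨b, c, rfl⟩ := Ideal.mem_span_pair.mp ih
    have hc : c ∈ IsLocalRing.maximalIdeal R := fun hc ↦ hzt j <| hc.mul_left_eq_zero.mp <| calc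
      z ^ m * t ^ j * c = z ^ m * (b * z + c * t ^ j) - b * z ^ (m + 1) := by ring
      _ = 0 := by rw [ha, hz, mul_zero, sub_zero]
    rw [hmax] at hc
    obtain ⟨x, y, rfl⟩ := Ideal.mem_span_pair.mp hc
    exact Ideal.mem_span_pair.mpr ⟨b + t ^ j * x, y, by ring⟩

lemma dvd_of_forall_mem_span_pair_pow [IsNoetherianRing R] (ht : t ∈ IsLocalRing.maximalIdeal R)
    (h : ∀ j, a ∈ Ideal.span {z, t ^ j}) : z ∣ a := by
  rw [← Ideal.mem_span_singleton, ← Ideal.Quotient.eq_zero_iff_mem, ← Submodule.mem_bot R,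
    ← Ideal.iInf_pow_smul_eq_bot_of_isLocalRing (IsLocalRing.maximalIdeal R)
      (Ideal.IsPrime.ne_top inferInstance), Submodule.mem_iInf]
  intro j
  obtain ⟨b, c, rfl⟩ := Ideal.mem_span_pair.mp (h j)
  have hbz : Ideal.Quotient.mk (Ideal.span {z}) (b * z + c * t ^ j) =
      t ^ j • Ideal.Quotient.mk (Ideal.span {z}) c := by
    rw [Algebra.smul_def, Ideal.Quotient.algebraMap_eq, ← map_mul,
      Ideal.Quotient.mk_eq_mk_iff_sub_mem]
    exact Ideal.mem_span_singleton.mpr ⟨b, by ring⟩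
  rw [hbz]
  exact Submodule.smul_mem_smul (Ideal.pow_mem_pow ht j) trivial

lemma IsCohenMacaulayLocalRing.exists_isSMulRegular (h : IsCohenMacaulayLocalRing R)
    (hR : nilradical R ≠ IsLocalRing.maximalIdeal R) :
    ∃ τ ∈ IsLocalRing.maximalIdeal R, IsSMulRegular R τ := by
  obtain ⟨_, rs, hrs, hreg, hdim⟩ := h
  cases rs with
  | nil =>
    have : Ring.KrullDimLE 0 R := Ring.krullDimLE_iff.mpr hdim.ge
    exact absurd (Ring.KrullDimLE.nilradical_eq_maximalIdeal R) hR
  | cons τ rs =>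
    exact ⟨τ, hrs τ (by simp), ((RingTheory.Sequence.isRegular_cons_iff R τ rs).mp hreg).1⟩

lemma IsCohenMacaulayLocalRing.exists_isNilpotentParameter (hR : IsCohenMacaulayLocalRing R)
    (hz : nilradical R = Ideal.span {z}) (hmax : IsLocalRing.maximalIdeal R = Ideal.span {z, t})
    (hne : nilradical R ≠ IsLocalRing.maximalIdeal R) : ∃ m, IsNilpotentParameter m z := by
  classical
  have : IsNoetherianRing R := hR.1
  obtain ⟨τ, hτ, hreg⟩ := hR.exists_isSMulRegular hne
  have hnil : IsNilpotent z := mem_nilradical.mp (hz ▸ Ideal.mem_span_singleton_self z)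
  obtain ⟨m, hm⟩ : ∃ m, Nat.find hnil = m + 1 := Nat.exists_eq_succ_of_ne_zero fun h0 ↦
    one_ne_zero ((pow_zero z).symm.trans (h0 ▸ Nat.find_spec hnil))
  have hzm : z ^ (m + 1) = 0 := hm ▸ Nat.find_spec hnil
  have hzm0 : z ^ m ≠ 0 := Nat.find_min hnil (by omega)
  exact ⟨m, hz, hzm, fun ha ↦ dvd_of_forall_mem_span_pair_pow
    (hmax ▸ Ideal.subset_span (by simp)) (mem_span_pair_pow_of_pow_mul_eq_zero hmax hzm
      (pow_mul_pow_ne_zero (hmax ▸ hτ) hreg hzm hzm0) ha)⟩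

end TwoGenerators

lemma ker_algebraMap_eq_map {A D : Type*} [CommRing A] [CommRing D] [Algebra A R] [Algebra R D]
    [Algebra A D] [IsScalarTower A R D] (hAR : Function.Surjective (algebraMap A R)) :
    RingHom.ker (algebraMap R D) = (RingHom.ker (algebraMap A D)).map (algebraMap A R) := by
  rw [IsScalarTower.algebraMap_eq A R D, ← RingHom.comap_ker,
    Ideal.map_comap_of_surjective _ hAR]

lemma maximalIdeal_eq_span_pair {D : Type*} [CommRing D] [IsLocalRing R] [IsLocalRing D]
    [Algebra R D] (hRD : Function.Surjective (algebraMap R D)) {z t : R}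
    (hker : RingHom.ker (algebraMap R D) = Ideal.span {z})
    (hmax : IsLocalRing.maximalIdeal D = Ideal.span {algebraMap R D t}) :
    IsLocalRing.maximalIdeal R = Ideal.span {z, t} := by
  have : (Ideal.comap (algebraMap R D) (IsLocalRing.maximalIdeal D)).IsMaximal :=
    Ideal.comap_isMaximal_of_surjective _ hRD
  rw [← IsLocalRing.eq_maximalIdeal this, hmax, ← Set.image_singleton,
    ← Ideal.map_span, Ideal.comap_map_of_surjective' _ hRD, hker, sup_comm, ← Ideal.span_union,
    Set.singleton_union]

-- For a primitive multiple curve: `A` is a local ring of a smooth surface containing `Y` locally,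
-- and `A → R → D → k` are the projections to the local rings of `Y`, of `C` and of a point.
lemma exists_isNilpotentParameter {K A R D k : Type*} [CommRing K] [CommRing A] [CommRing R]
    [CommRing D] [Field k] [IsLocalRing A] [IsLocalRing R] [IsLocalRing D] [IsNoetherianRing A]
    [Algebra K A] [Algebra K D] [Algebra K k] [Algebra A R] [Algebra R D] [Algebra A D]
    [Algebra D k] [IsScalarTower K A D] [IsScalarTower K D k] [IsScalarTower A R D]
    (hA : IsFormallySmoothOfRank K A 2) (hD : IsFormallySmoothOfRank K D 1)
    (hk : Function.Bijective (algebraMap K k)) (hAR : Function.Surjective (algebraMap A R))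
    (hRD : Function.Surjective (algebraMap R D)) (hDk : Function.Surjective (algebraMap D k))
    (hker : RingHom.ker (algebraMap R D) = nilradical R) (hR : IsCohenMacaulayLocalRing R) :
    ∃ (m : ℕ) (z : R), IsNilpotentParameter m z := by
  have hAD : Function.Surjective (algebraMap A D) := by
    rw [IsScalarTower.algebraMap_eq A R D]
    exact hRD.comp hAR
  have : IsNoetherianRing D := isNoetherianRing_of_surjective A D _ hAD
  obtain ⟨f, -, hf⟩ := hA.exists_ker_eq_span_singleton hAD hD
  obtain ⟨t', ht0, ht'⟩ := hD.exists_ker_eq_span_singleton hDk (.of_bijective hk)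
  have hmaxD : IsLocalRing.maximalIdeal D = Ideal.span {t'} := ht' ▸
    (IsLocalRing.eq_maximalIdeal (RingHom.ker_isMaximal_of_surjective _ hDk)).symm
  obtain ⟨t, rfl⟩ := hRD t'
  have hz : RingHom.ker (algebraMap R D) = Ideal.span {algebraMap A R f} := by
    rw [ker_algebraMap_eq_map hAR, hf, Ideal.map_span, Set.image_singleton]
  have hmax := maximalIdeal_eq_span_pair hRD hz hmaxD
  have hne : nilradical R ≠ IsLocalRing.maximalIdeal R := fun h ↦ ht0 <| by
    rw [← RingHom.mem_ker, hker, h, hmax]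
    exact Ideal.subset_span (by simp)
  obtain ⟨m, hm⟩ := hR.exists_isNilpotentParameter (hker ▸ hz) hmax hne
  exact ⟨m, _, hm⟩

end NilpotentParameter

section Stalks

/-- The structure of `ℂ`-algebra on the stalks of a scheme over `ℂ`. -/
def stalkBase {X : Scheme.{0}} (f : X ⟶ Spec (.of ℂ)) (x : X) : ℂ →+* X.presheaf.stalk x :=
  ((Scheme.ΓSpecIso (.of ℂ)).inv ≫ f.appTop ≫ X.presheaf.germ ⊤ x trivial).hom

lemma stalkBase_comp {X Y : Scheme.{0}} (h : X ⟶ Y) (g : Y ⟶ Spec (.of ℂ)) (x : X) :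
    stalkBase (h ≫ g) x = (h.stalkMap x).hom.comp (stalkBase g (h x)) := by
  rw [stalkBase, stalkBase, ← CommRingCat.hom_comp]
  congr 1
  rw [Category.assoc, Category.assoc, Scheme.Hom.comp_appTop, Category.assoc]
  congr 2
  exact (Scheme.Hom.germ_stalkMap h ⊤ x trivial).symm

lemma isFormallySmoothOfRank_stalk {X : Scheme.{0}} (f : X ⟶ Spec (.of ℂ)) (p : ℕ)
    [SmoothOfRelativeDimension p f] (x : X) :
    letI := (stalkBase f x).toAlgebra
    IsFormallySmoothOfRank ℂ (X.presheaf.stalk x) p := by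
  obtain ⟨U, hU, V, hV, hx, e, hf⟩ :=
    SmoothOfRelativeDimension.exists_isStandardSmoothOfRelativeDimension (n := p) (f := f) x
  obtain rfl : U = ⊤ := top_le_iff.mp fun y _ ↦ by
    rw [Subsingleton.elim y (f x)]
    exact e hx
  let r : ℂ →+* Γ(X, V) := ((Scheme.ΓSpecIso (.of ℂ)).inv ≫ f.appLE ⊤ V e).hom
  have hr : RingHom.IsStandardSmoothOfRelativeDimension p r :=
    RingHom.isStandardSmoothOfRelativeDimension_respectsIso.2 _
      (Scheme.ΓSpecIso (.of ℂ)).symm.commRingCatIsoToRingEquiv hf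
  let := r.toAlgebra
  let := (stalkBase f x).toAlgebra
  let := X.presheaf.algebra_section_stalk ⟨x, hx⟩
  have : IsScalarTower ℂ Γ(X, V) (X.presheaf.stalk x) := .of_algebraMap_eq' (by
    change stalkBase f x = (((Scheme.ΓSpecIso (.of ℂ)).inv ≫ f.appLE ⊤ V e) ≫
      X.presheaf.germ V x hx).hom
    rw [stalkBase, Category.assoc, Scheme.Hom.appLE, Category.assoc, X.presheaf.germ_res]
    rfl)
  have := hV.isLocalization_stalk ⟨x, hx⟩
  exact .of_isLocalization (hV.primeIdealOf ⟨x, hx⟩).asIdeal.primeCompl hr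

lemma SpecMap_stalkBase {X : Scheme.{0}} (f : X ⟶ Spec (.of ℂ)) (x : X) :
    Spec.map (CommRingCat.ofHom (stalkBase f x)) = X.fromSpecStalk x ≫ f := by
  rw [stalkBase, CommRingCat.ofHom_hom, Spec.map_comp, Spec.map_comp,
    ← Scheme.fromSpecStalk_toSpecΓ, Category.assoc, Category.assoc,
    ← Scheme.toSpecΓ_naturality_assoc, toSpecΓ_SpecMap_ΓSpecIso_inv, Category.comp_id]

lemma bijective_residue_comp_stalkBase {X : Scheme.{0}} (f : X ⟶ Spec (.of ℂ))
    [LocallyOfFiniteType f] (x : X) (hx : IsClosed {x}) :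
    Function.Bijective ((X.residue x).hom.comp (stalkBase f x)) := by
  have hinv : (residueFieldIsoBase f x hx).inv =
      CommRingCat.ofHom (stalkBase f x) ≫ X.residue x := by
    apply Spec.map_injective
    rw [SpecMap_residueFieldIsoBase_inv, Spec.map_comp, SpecMap_stalkBase,
      Scheme.fromSpecResidueField, Category.assoc]
  change Function.Bijective (CommRingCat.ofHom (stalkBase f x) ≫ X.residue x).hom
  rw [← hinv]
  exact (residueFieldIsoBase f x hx).symm.commRingCatIsoToRingEquiv.bijective

lemma exists_surjective_stalk_of_isImmersion {X S : Scheme.{0}} {π : X ⟶ Spec (.of ℂ)}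
    {σ : S ⟶ Spec (.of ℂ)} {U : X.Opens} (j : (U : Scheme.{0}) ⟶ S) [IsImmersion j]
    (hj : j ≫ σ = U.ι ≫ π) (x : (U : Scheme.{0})) :
    ∃ ρ : S.presheaf.stalk (j x) →+* X.presheaf.stalk x.1,
      Function.Surjective ρ ∧ ρ.comp (stalkBase σ (j x)) = stalkBase π x.1 := by
  let e : X.presheaf.stalk x.1 ⟶ (U : Scheme.{0}).presheaf.stalk x := U.ι.stalkMap x
  have : IsIso e := inferInstanceAs (IsIso (U.ι.stalkMap x))
  let ρ : S.presheaf.stalk (j x) ⟶ X.presheaf.stalk x.1 := j.stalkMap x ≫ inv e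
  have hρ : CommRingCat.ofHom (stalkBase σ (j x)) ≫ ρ = CommRingCat.ofHom (stalkBase π x.1) := by
    rw [← cancel_mono e, Category.assoc, Category.assoc, IsIso.inv_hom_id, Category.comp_id]
    ext1
    exact (stalkBase_comp j σ x).symm.trans (hj ▸ stalkBase_comp U.ι π x)
  refine ⟨ρ.hom, ?_, congr_arg CommRingCat.Hom.hom hρ⟩
  change Function.Surjective (inv e ∘ j.stalkMap x)
  exact (ConcreteCategory.bijective_of_isIso (inv e)).2.comp (j.stalkMap_surjective x)

end Stalks

section Reduction

variable {X Y : Scheme.{u}}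

lemma germ_ringRes {U V : Y.Opens} (h : V ≤ U) {x : Y} (hx : x ∈ V) (g : Γ(Y, U)) :
    Y.presheaf.germ V x hx (ringRes h g) = Y.presheaf.germ U x (h hx) g :=
  Y.presheaf.germ_res_apply (homOfLE h) x hx g

lemma exists_affine_germ_eq (x : Y) (r : Y.presheaf.stalk x) :
    ∃ (V : Y.affineOpens) (hx : x ∈ V.1) (g : Γ(Y, V.1)), Y.presheaf.germ V.1 x hx g = r := by
  obtain ⟨U, hU, g, rfl⟩ := Y.presheaf.exists_germ_eq r
  obtain ⟨V, hV, hVU⟩ := exists_affine Y hU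
  exact ⟨V, hV, ringRes hVU g, germ_ringRes hVU hV g⟩

lemma exists_affine_ringRes_eq_zero {x : Y} {V : Y.Opens} (hx : x ∈ V) {g : Γ(Y, V)}
    (h : Y.presheaf.germ V x hx g = 0) :
    ∃ (W : Y.affineOpens) (hW : W.1 ≤ V), x ∈ W.1 ∧ ringRes hW g = 0 := by
  obtain ⟨U, hU, i, j, e⟩ := Y.presheaf.germ_eq x hx hx g 0 (h.trans (map_zero _).symm)
  obtain ⟨W, hW, hWU⟩ := exists_affine Y hU
  refine ⟨W, hWU.trans (leOfHom i), hW, ?_⟩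
  rw [← ringRes_ringRes (leOfHom i) hWU, show ringRes (leOfHom i) g = 0 from e.trans (map_zero _),
    map_zero]

lemma eq_zero_of_germ_eq_zero {V : Y.Opens} (a : Γ(Y, V))
    (h : ∀ x hx, Y.presheaf.germ V x hx a = 0) : a = 0 :=
  TopCat.Presheaf.section_ext Y.sheaf V a 0 fun x hx ↦ (h x hx).trans (map_zero _).symm

lemma exists_affine_app_eq_zero_of_stalkMap_eq_zero {f : X ⟶ Y} (hf : Topology.IsInducing f)
    {x : X} {V : Y.Opens} (hx : f x ∈ V) {g : Γ(Y, V)}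
    (h : f.stalkMap x (Y.presheaf.germ V _ hx g) = 0) :
    ∃ (W : Y.affineOpens) (hW : W.1 ≤ V), f x ∈ W.1 ∧ f.app W.1 (ringRes hW g) = 0 := by
  rw [Scheme.Hom.germ_stalkMap_apply] at h
  obtain ⟨W, hW, hxW, hzero⟩ := exists_affine_ringRes_eq_zero _ h
  obtain ⟨T, hT, hWT⟩ := hf.isOpen_iff.mp W.1.2
  obtain ⟨W', hxW', hW'⟩ := exists_affine Y (U := ⟨T, hT⟩ ⊓ V) (x := f x)
    ⟨show x ∈ f ⁻¹' T from hWT ▸ hxW, hx⟩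
  have hle : f ⁻¹ᵁ W'.1 ≤ W.1 := fun y hy ↦ by
    have hyT : y ∈ f ⁻¹' T := (hW' hy).1
    rwa [hWT] at hyT
  have happ : f.app W'.1 (ringRes (hW'.trans inf_le_right) g) =
      ringRes hle (ringRes hW (f.app V g)) := by
    rw [ringRes_ringRes]
    exact ConcreteCategory.congr_hom (f.naturality (homOfLE (hW'.trans inf_le_right)).op) g
  exact ⟨W', hW'.trans inf_le_right, hxW', by rw [happ, hzero, map_zero]⟩

lemma mem_nilradical_ideal_iff {V : Y.affineOpens} {a : Γ(Y, V.1)} :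
    a ∈ Y.nilradical.ideal V ↔ IsNilpotent a := Iff.rfl

lemma subschemeι_nilradical_app_eq_zero_iff {W : Y.affineOpens} {a : Γ(Y, W.1)} :
    Y.nilradical.subschemeι.app W.1 a = 0 ↔ IsNilpotent a := by
  rw [← mem_nilradical_ideal_iff, ← Scheme.IdealSheafData.ker_subschemeι_app]
  rfl

lemma subschemeι_nilradical_surjective : Function.Surjective Y.nilradical.subschemeι :=
  Set.range_eq_univ.mp <| by
    rw [Scheme.IdealSheafData.range_subschemeι, Scheme.support_nilradical]
    rfl

lemma ker_stalkMap_subschemeι_nilradical (c : Y.nilradical.subscheme) :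
    RingHom.ker (Y.nilradical.subschemeι.stalkMap c).hom =
      nilradical (Y.presheaf.stalk (Y.nilradical.subschemeι c)) := by
  ext r
  rw [RingHom.mem_ker, mem_nilradical]
  obtain ⟨V, hx, g, rfl⟩ := exists_affine_germ_eq _ r
  refine ⟨fun h ↦ ?_, fun ⟨N, hN⟩ ↦ ?_⟩
  · obtain ⟨W, hW, hxW, hg⟩ := exists_affine_app_eq_zero_of_stalkMap_eq_zero
      Y.nilradical.subschemeι.isEmbedding.isInducing hx h
    rw [← germ_ringRes hW hxW]
    exact (subschemeι_nilradical_app_eq_zero_iff.mp hg).map _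
  · rw [← map_pow] at hN
    obtain ⟨W, hW, hxW, hg⟩ := exists_affine_ringRes_eq_zero _ hN
    have hnil : IsNilpotent (ringRes hW g) := ⟨N, by rw [← map_pow, hg]⟩
    rw [← germ_ringRes hW hxW]
    refine (Scheme.Hom.germ_stalkMap_apply _ _ _ _ _).trans ?_
    rw [subschemeι_nilradical_app_eq_zero_iff.mpr hnil, map_zero]

end Reduction

section LocallyPrimitive

variable {Y : Scheme.{u}}

/-- The scheme `Y` looks near `y` like a primitive multiple curve of multiplicity `m + 1`: on a
neighbourhood of `y` there is a section all of whose germs are nilpotent parameters. -/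
def IsLocallyPrimitive (m : ℕ) (y : Y) : Prop :=
  ∃ (V : Y.Opens) (ζ : Γ(Y, V)), y ∈ V ∧
    ∀ (w : Y) (hw : w ∈ V), IsNilpotentParameter m (Y.presheaf.germ V w hw ζ)

lemma IsNilpotentParameter.isLocallyPrimitive [IsLocallyNoetherian Y] {x : Y} {m : ℕ}
    {z : Y.presheaf.stalk x} (hz : IsNilpotentParameter m z) : IsLocallyPrimitive m x := by
  obtain ⟨V, hxV, -⟩ := exists_affine Y (U := ⊤) (x := x) trivial
  have := IsLocallyNoetherian.component_noetherian V
  let _ := Y.presheaf.algebra_section_stalk ⟨x, hxV⟩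
  have := V.2.isLocalization_stalk ⟨x, hxV⟩
  obtain ⟨ζ, s, hs, spread⟩ := hz.exists_forall_localization
    (V.2.primeIdealOf ⟨x, hxV⟩).asIdeal.primeCompl
  have hxs : x ∈ Y.basicOpen s := (Scheme.mem_basicOpen _ _ _ hxV).mpr
    (IsLocalization.map_units (Y.presheaf.stalk x)
      (⟨s, hs⟩ : (V.2.primeIdealOf ⟨x, hxV⟩).asIdeal.primeCompl))
  refine ⟨Y.basicOpen s, ringRes (Y.basicOpen_le s) ζ, hxs, fun y hy ↦ ?_⟩
  have hyV := Y.basicOpen_le s hy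
  let _ := Y.presheaf.algebra_section_stalk ⟨y, hyV⟩
  have := V.2.isLocalization_stalk ⟨y, hyV⟩
  rw [germ_ringRes]
  exact spread (V.2.primeIdealOf ⟨y, hyV⟩).asIdeal.primeCompl (Y.presheaf.stalk y)
    ((Scheme.mem_basicOpen _ _ _ hyV).mp hy)

lemma IsLocallyPrimitive.eq_of_preconnectedSpace [PreconnectedSpace Y] {m : Y → ℕ}
    (h : ∀ y, IsLocallyPrimitive (m y) y) (x y : Y) : m x = m y := by
  choose V ζ hV hζ using h
  refine IsLocallyConstant.apply_eq_of_preconnectedSpace ?_ x y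
  exact (IsLocallyConstant.iff_exists_open m).mpr fun y ↦ ⟨V y, (V y).2, hV y,
    fun w hw ↦ (hζ w w (hV w)).eq_of_nontrivial (hζ y w hw)⟩

lemma isLocalParameter_of_forall_isNilpotentParameter {V : Y.Opens} {z : Γ(Y, V)} {m : ℕ}
    (h : ∀ (y : Y) (hy : y ∈ V), IsNilpotentParameter m (Y.presheaf.germ V y hy z)) :
    IsLocalParameter (m + 1) V z where
  ideal_eq W hW := by
    refine le_antisymm (fun c hc ↦ ?_) ?_
    · refine W.2.mem_ideal_iff.mpr fun y hy ↦ ?_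
      have hspan : Ideal.map (Y.presheaf.germ W.1 y hy).hom (Ideal.span {ringRes hW z}) =
          Ideal.span {Y.presheaf.germ V y (hW hy) z} := by
        rw [Ideal.map_span, Set.image_singleton, ← germ_ringRes hW hy]
      rw [hspan, ← (h y (hW hy)).nilradical_eq]
      exact (mem_nilradical_ideal_iff.mp hc).map _
    · rw [Ideal.span_singleton_le_iff_mem, mem_nilradical_ideal_iff]
      refine ⟨m + 1, eq_zero_of_germ_eq_zero _ fun y hy ↦ ?_⟩
      rw [map_pow, germ_ringRes, (h y (hW hy)).pow_succ_eq_zero]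
  pow_eq_zero := eq_zero_of_germ_eq_zero _ fun y hy ↦ by
    rw [map_pow, (h y hy).pow_succ_eq_zero]
  dvd_of_pow_mul_eq_zero W hW k hk c hc := by
    refine Ideal.mem_span_singleton.mp (W.2.mem_ideal_iff.mpr fun y hy ↦ ?_)
    have hc := congr_arg (Y.presheaf.germ W.1 y hy) hc
    rw [map_mul, map_pow, map_zero, germ_ringRes hW hy] at hc
    have hdvd := (h y (hW hy)).pow_dvd_of_pow_mul_eq_zero hk hc
    rw [← germ_ringRes hW hy, ← map_pow] at hdvd
    rw [Ideal.map_span, Set.image_singleton, Ideal.mem_span_singleton]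
    exact hdvd

lemma hasLocalParameters_of_isLocallyPrimitive {m : ℕ} (h : ∀ y : Y, IsLocallyPrimitive m y) :
    HasLocalParameters Y (m + 1) := fun y ↦
  let ⟨V, ζ, hy, hζ⟩ := h y
  ⟨V, ζ, hy, isLocalParameter_of_forall_isNilpotentParameter hζ⟩

lemma HasLocalParameters.nilradical_pow_eq_bot {n : ℕ} (h : HasLocalParameters Y n) :
    Y.nilradical ^ n = ⊥ := by
  refine Scheme.IdealSheafData.ext (funext fun W ↦ (Submodule.eq_bot_iff _).mpr fun c hc ↦ ?_)
  refine eq_zero_of_germ_eq_zero c fun y hy ↦ ?_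
  obtain ⟨V, z, hyV, hz⟩ := h y
  obtain ⟨W', hyW', hW'⟩ := exists_affine Y (U := V ⊓ W.1) ⟨hyV, hy⟩
  have hcW' : ringRes (hW'.trans inf_le_right) c ∈ (Y.nilradical ^ n).ideal W' :=
    map_mem_ideal _ (V := W) (W := W') (homOfLE (hW'.trans inf_le_right)) hc
  rw [hz.pow_ideal_eq W' (hW'.trans inf_le_left), ← map_pow, hz.pow_eq_zero, map_zero,
    Ideal.span_singleton_eq_bot.mpr rfl, Ideal.mem_bot] at hcW'
  rw [← germ_ringRes (hW'.trans inf_le_right) hyW', hcW', map_zero]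

lemma IsLocallyPrimitive.lt_of_nilradical_pow_eq_bot {m n : ℕ} {y : Y}
    (hy : IsLocallyPrimitive m y) (h : Y.nilradical ^ n = ⊥) : m < n := by
  obtain ⟨V, ζ, hyV, hζ⟩ := hy
  obtain ⟨W, hyW, hW⟩ := exists_affine Y hyV
  have hmem : ringRes hW ζ ^ n ∈ (Y.nilradical ^ n).ideal W := by
    rw [(isLocalParameter_of_forall_isNilpotentParameter hζ).pow_ideal_eq W hW]
    exact Ideal.mem_span_singleton_self _
  have hpow : ringRes hW ζ ^ n = 0 := by rwa [h] at hmem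
  refine (hζ y hyV).pow_eq_zero_iff.mp ?_
  rw [← germ_ringRes hW hyW, ← map_pow, hpow, map_zero]

end LocallyPrimitive

section PrimitiveCurve

variable {Y : Scheme.{0}} {π : Y ⟶ Spec (.of ℂ)} {n : ℕ}

lemma exists_isNilpotentParameter_of_surjective_stalk [LocallyOfFiniteType π]
    [SmoothOfRelativeDimension 1 (Y.nilradical.subschemeι ≫ π)] {S : Scheme.{0}}
    (σ : S ⟶ Spec (.of ℂ)) [SmoothOfRelativeDimension 2 σ] {s : S} {c : Y.nilradical.subscheme}
    (hc : IsClosed {c})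
    (hY : IsCohenMacaulayLocalRing (Y.presheaf.stalk (Y.nilradical.subschemeι c)))
    (ρ : S.presheaf.stalk s →+* Y.presheaf.stalk (Y.nilradical.subschemeι c))
    (hρ : Function.Surjective ρ) (hρσ : ρ.comp (stalkBase σ s) = stalkBase π _) :
    ∃ (m : ℕ) (z : Y.presheaf.stalk (Y.nilradical.subschemeι c)), IsNilpotentParameter m z := by
  let i := Y.nilradical.subschemeι
  have := SmoothOfRelativeDimension.smooth 2 σ
  have : IsLocallyNoetherian S := LocallyOfFiniteType.isLocallyNoetherian σ
  let A := S.presheaf.stalk s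
  let R := Y.presheaf.stalk (i c)
  let D := Y.nilradical.subscheme.presheaf.stalk c
  let k := Y.nilradical.subscheme.residueField c
  let _ : Algebra ℂ A := (stalkBase σ s).toAlgebra
  let _ : Algebra ℂ D := (stalkBase (i ≫ π) c).toAlgebra
  let _ : Algebra ℂ k :=
    ((Y.nilradical.subscheme.residue c).hom.comp (stalkBase (i ≫ π) c)).toAlgebra
  let _ : Algebra A R := ρ.toAlgebra
  let _ : Algebra R D := (i.stalkMap c).hom.toAlgebra
  let _ : Algebra A D := ((i.stalkMap c).hom.comp ρ).toAlgebra
  let _ : Algebra D k := (Y.nilradical.subscheme.residue c).hom.toAlgebra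
  have : IsScalarTower A R D := .of_algebraMap_eq' rfl
  have : IsScalarTower ℂ D k := .of_algebraMap_eq' rfl
  have : IsScalarTower ℂ A D := .of_algebraMap_eq' (by
    change stalkBase (i ≫ π) c = ((i.stalkMap c).hom.comp ρ).comp (stalkBase σ s)
    rw [RingHom.comp_assoc, hρσ, stalkBase_comp])
  exact exists_isNilpotentParameter (K := ℂ) (A := A) (R := R) (D := D) (k := k)
    (isFormallySmoothOfRank_stalk σ 2 s) (isFormallySmoothOfRank_stalk (i ≫ π) 1 c)
    (bijective_residue_comp_stalkBase (i ≫ π) c hc) hρ (i.stalkMap_surjective c)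
    (Y.nilradical.subscheme.residue_surjective c) (ker_stalkMap_subschemeι_nilradical c) hY

lemma exists_isClosed_singleton_forall_mem {X : Type*} [TopologicalSpace X] [JacobsonSpace X]
    (y : X) : ∃ x : X, IsClosed {x} ∧ ∀ V : Set X, IsOpen V → x ∈ V → y ∈ V := by
  obtain ⟨x, hx, hx'⟩ := nonempty_inter_closedPoints (Z := closure {y})
    ⟨y, subset_closure rfl⟩ isClosed_closure.isLocallyClosed
  refine ⟨x, hx', fun V hV hxV ↦ ?_⟩
  obtain ⟨w, hw, rfl⟩ := mem_closure_iff.mp hx V hV hxV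
  exact hw

namespace IsPrimitiveMultipleCurve

lemma exists_isNilpotentParameter (hY : IsPrimitiveMultipleCurve π n) {x : Y}
    (hx : IsClosed {x}) : ∃ (m : ℕ) (z : Y.presheaf.stalk x), IsNilpotentParameter m z := by
  obtain ⟨S, σ, U, j, hxU, _, _, hj⟩ := hY.primitive x hx
  have := hY.locallyOfFiniteType
  have := hY.support.smooth
  obtain ⟨c, rfl⟩ := subschemeι_nilradical_surjective x
  have hc : IsClosed {c} := by
    rw [← Y.nilradical.subschemeι.isEmbedding.injective.preimage_image {c}, Set.image_singleton]
    exact hx.preimage Y.nilradical.subschemeι.continuous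
  obtain ⟨ρ, hρ, hρσ⟩ := exists_surjective_stalk_of_isImmersion j hj ⟨_, hxU⟩
  exact exists_isNilpotentParameter_of_surjective_stalk σ hc (hY.cohenMacaulay _) ρ hρ hρσ

lemma exists_isLocallyPrimitive (hY : IsPrimitiveMultipleCurve π n) (y : Y) :
    ∃ m, IsLocallyPrimitive m y := by
  have := hY.locallyOfFiniteType
  have : IsLocallyNoetherian Y := LocallyOfFiniteType.isLocallyNoetherian π
  have : JacobsonSpace Y := LocallyOfFiniteType.jacobsonSpace π
  obtain ⟨x, hx, hxy⟩ := exists_isClosed_singleton_forall_mem y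
  obtain ⟨m, z, hz⟩ := hY.exists_isNilpotentParameter hx
  obtain ⟨V, ζ, hxV, hζ⟩ := hz.isLocallyPrimitive
  exact ⟨m, V, ζ, hxy V V.2 hxV, hζ⟩

lemma connectedSpace (hY : IsPrimitiveMultipleCurve π n) : ConnectedSpace Y :=
  have := hY.support.connected
  subschemeι_nilradical_surjective.connectedSpace Y.nilradical.subschemeι.continuous

lemma hasLocalParameters (hY : IsPrimitiveMultipleCurve π n) : HasLocalParameters Y n := by
  have := hY.connectedSpace
  choose m hm using hY.exists_isLocallyPrimitive
  obtain ⟨x⟩ : Nonempty Y := inferInstance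
  have hparam : HasLocalParameters Y (m x + 1) := hasLocalParameters_of_isLocallyPrimitive
    fun y ↦ IsLocallyPrimitive.eq_of_preconnectedSpace hm y x ▸ hm y
  obtain rfl : n = m x + 1 := le_antisymm (hY.multiplicity.2 hparam.nilradical_pow_eq_bot)
    ((hm x).lt_of_nilradical_pow_eq_bot hY.multiplicity.1)
  exact hparam

end IsPrimitiveMultipleCurve

end PrimitiveCurve

end MultipleCurve

end

universe u

theorem lemma3p1p1_general {Y : Scheme.{u}} {E F : Y.Modules} {n k : ℕ} {φ : E ⟶ F} [Epi φ]
    (hn : Y.nilradical ^ n = ⊥) (hk : k ≤ n) (hY : HasLocalParameters Y n)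
    (hE : HasLocalFrames n E) (hF : HasLocalFrames k F)
    (hφ : ∀ {A : Y.Opens} {m : Γ(E, A)}, φ.app A m = 0 → m ∈ (firstFiltration E 1).obj A) :
    ∃! θ : restrictTo (kernel φ) k ≅ tensor (filtrationQuotient hn hk F) (idealPow Y k),
      ∀ (U : Y.Opens) (u : Γ((secondFiltration F k).toModules, U)) (s : Γ(idealPow Y k, U))
        (v : Γ(E, U)) (l : Γ(kernel φ, U)),
        φ.app U v = (secondFiltration F k).ι.app U u →
        (kernel.ι φ).app U l = idealPow.val s • v →
        θ.hom.app U ((toRestrict (kernel φ) k).app U l) =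
          tmul ((toFiltrationQuotient hn hk F).app U u) s := by
  have := mono_comparisonHom (φ := φ) hn hk hY hE
  have := epi_comparisonHom (φ := φ) hn hk hY hF hφ
  have := isIso_of_mono_of_epi (comparisonHom hn hk φ)
  refine ⟨(asIso (comparisonHom hn hk φ)).symm, fun U u s v l hv hl ↦ ?_, fun θ hθ ↦ ?_⟩
  · rw [← comparisonHom_app_tmul_of_rel (hn := hn) (hk := hk) ⟨u, v, l, hv, hl, rfl, rfl⟩,
      ← comp_app_apply]
    simp
  · refine Iso.ext (IsIso.eq_inv_of_hom_inv_id (comparisonHom_comp_eq_id ?_))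
    rintro U _ s _ ⟨u, v, l, hv, hl, rfl, rfl⟩
    exact hθ U u s v l hv hl

theorem lemma3p1p1 {Y : Scheme.{0}} (π : Y ⟶ Spec (.of ℂ)) (n : ℕ)
    (hY : IsPrimitiveMultipleCurve π n)
    (a b k : ℕ) (ha : 0 < a) (hb : 0 < b) (hk : 1 ≤ k) (hkn : k < n)
    (ℰ : Y.Modules) (hℰ : LocallyIsomorphic ℰ (quasiFreeModel Y a b k))
    (𝔼 : Y.Modules) (h𝔼 : IsVectorBundle 𝔼)
    (φ : 𝔼 ⟶ ℰ) (hφ : Epi φ)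
    (hφC : ∃ ψ : restrictTo 𝔼 1 ≅ restrictTo ℰ 1, toRestrict 𝔼 1 ≫ ψ.hom = φ ≫ toRestrict ℰ 1) :
    ∃! θ : restrictTo (kernel φ) k ≅
        tensor (filtrationQuotient hY.multiplicity.1 hkn.le ℰ) (idealPow Y k),
      ∀ (U : Y.Opens) (u : Γ((secondFiltration ℰ k).toModules, U)) (s : Γ(idealPow Y k, U))
        (v : Γ(𝔼, U)) (l : Γ(kernel φ, U)),
        φ.app U v = (secondFiltration ℰ k).ι.app U u →
        (kernel.ι φ).app U l = idealPow.val s • v →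
        θ.hom.app U ((toRestrict (kernel φ) k).app U l) =
          tmul ((toFiltrationQuotient hY.multiplicity.1 hkn.le ℰ).app U u) s := by
  obtain ⟨ψ, hψ⟩ := hφC
  exact lemma3p1p1_general hY.multiplicity.1 hkn.le hY.hasLocalParameters (h𝔼.hasLocalFrames n)
    (hℰ.hasLocalFrames (hasFrame_quasiFreeModel a b k)) (mem_firstFiltration_one_of_app_eq_zero hψ)
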